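/- Let $c=\alpha+\beta i\in\mathbb C$ with $|c|>1$ and $\beta>0$, and let $f=f_c:\mathbb C\to\mathbb C$ be the twisted tent map $f(z)=cz$ if $\Im(cz)\ge -1$ and $f(z)=\overline{cz}-2i$ if $\Im(cz)\le -1$. Let $K$ be the set of points with bounded forward orbit under $f$. Let $FL=\{z:\Im z=-1\}$ (the folding line), $PFL=f^{-1}(FL)$ (the pre-folding line), $PH^+=\{z: f(z)=cz\}$, $PH^-=\{z:f(z)=\overline{cz}-2i\}$, let $\{\gamma_0\}=FL\cap PFL$, and let $z'=(\overline{cz}-2i)/c$ be the reflection of $z$ in $PFL$; for a set $X$ put $X'=\{z':z\in X\}$. Put $\ell_0=\frac{2i(1-\overline c)}{|c|^2-1}$, $\ell_k=\ell_0/c^k$ for $k>0$, $\ell_k=(\ell_{-k+1})'$ for $k<0$, let $L_k=[\ell_k,\ell_{k+1}]$ for $k\in\mathbb Z$, and let $L=\bigcup_{k\ge1}L_k$ (a spiral). Let $m_0,m_1$ be the midpoints of $L_0,L_1$; they lie on the lines $PFL$ and $PFL/c$ respectively. The broken line $[m_0,\ell_1]\cup[\ell_1,m_1]$ cuts the closed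 sector $PH^+\cap(PH^- /c)$ between these lines into a bounded and an unbounded part; let $S_1$ be the unbounded part (closed). For $k\ge2$ put $S_k=(S_{k-1}/c)\cap PH^+$, and let $S=\bigcup_{k\ge1}S_k$. The perimeter set is $P=\mathbb C\setminus\operatorname{Int}(S\cup S')$. Suppose that $L$ meets $PFL$, let $n$ be the smallest positive integer with $L_n\cap PFL\ne\emptyset$, and let $\{\zeta\}=L_n\cap PFL$. The outer-most boundary of $P$ is then $$[\ell_n,\zeta]\cup[\ell_{-(n-1)},\zeta]\cup\bigcup_{|k|\le n-1}L_k .$$ If $\Im(\zeta)\le -1$, then: 1. $P$ is the polygon bounded by the outer-most boundary of $P$; that is, the outer-most boundary is a simple closed polygonal curve, and $P$ consists of this curve together with the points enclosed by it; 2. $P=K$; 3. $\gamma_0\in K$. -/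

import Mathlib

namespace TTM

noncomputable section

/-- The folding line `Im z = -1`. -/
def FL : Set ℂ := {z | z.im = -1}

/-- The twisted tent map `f_c`: multiply by `c`, then reflect the half plane `Im < -1`
in the folding line. -/
def f (c z : ℂ) : ℂ :=
  if -1 ≤ (c * z).im then c * z else (starRingEnd ℂ) (c * z) - 2 * Complex.I

/-- The filled-in Julia set: points with bounded forward orbit. -/
def K (c : ℂ) : Set ℂ := {z | Bornology.IsBounded (Set.range fun n : ℕ => (f c)^[n] z)}

/-- The pre-folding line, the preimage of the folding line. -/
def PFL (c : ℂ) : Set ℂ := f c ⁻¹' FL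

/-- The pre-upper half plane. -/
def PHplus (c : ℂ) : Set ℂ := {z | f c z = c * z}

/-- The pre-lower half plane. -/
def PHminus (c : ℂ) : Set ℂ := {z | f c z = (starRingEnd ℂ) (c * z) - 2 * Complex.I}

/-- Reflection in the pre-folding line: rotate and scale by `c`, reflect in the folding line
(`w ↦ conj w - 2 i`), undo the multiplication. -/
def reflPFL (c z : ℂ) : ℂ := ((starRingEnd ℂ) (c * z) - 2 * Complex.I) / c

/-- The point `γ₀` where the folding line and the pre-folding line cross
(see `FL_inter_PFL`). -/
def gamma0 (c : ℂ) : ℂ := ⟨(c.re - 1) / c.im, -1⟩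

theorem mem_PFL_iff (c z : ℂ) : z ∈ PFL c ↔ (c * z).im = -1 := by
  simp only [PFL, FL, Set.mem_preimage, Set.mem_ofPred_eq, f]
  split_ifs with h
  · rfl
  · simp only [Complex.sub_im, Complex.conj_im, Complex.mul_im, Complex.I_im, Complex.I_re,
      Complex.re_ofNat, Complex.im_ofNat] at h ⊢
    constructor <;> intro h' <;> linarith

theorem FL_inter_PFL (c : ℂ) (hc : 0 < c.im) : FL ∩ PFL c = {gamma0 c} := by
  ext z
  simp only [Set.mem_inter_iff, mem_PFL_iff, Set.mem_singleton_iff, FL, Set.mem_ofPred_eq,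
    gamma0, Complex.ext_iff, Complex.mul_im]
  rw [eq_div_iff hc.ne']
  constructor
  · rintro ⟨h1, h2⟩
    rw [h1] at h2
    exact ⟨by linarith, h1⟩
  · rintro ⟨h1, h2⟩
    rw [h2]
    exact ⟨rfl, by linarith⟩

/-- The fixed point `ℓ₀ = 2 i (1 - conj c) / (|c|² - 1)`. -/
def ell0 (c : ℂ) : ℂ :=
  2 * Complex.I * (1 - (starRingEnd ℂ) c) / (((‖c‖ ^ 2 - 1 : ℝ)) : ℂ)

/-- The points `ℓ_k`: `ℓ₀ / c ^ k` for `k ≥ 0`, and the mirror image of `ℓ_{-k+1}` in the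
pre-folding line for `k < 0`. -/
def ell (c : ℂ) (k : ℤ) : ℂ :=
  if 0 ≤ k then ell0 c / c ^ k else reflPFL c (ell0 c / c ^ (-k + 1))

/-- The segment `L_k = [ℓ_k, ℓ_{k+1}]`. -/
def Lseg (c : ℂ) (k : ℤ) : Set ℂ := segment ℝ (ell c k) (ell c (k + 1))

/-- `z` lies on the left of, or on, the line through `a` and `b`, directed from `a` to `b`. -/
def OnLeft (a b z : ℂ) : Prop := 0 ≤ ((starRingEnd ℂ) (b - a) * (z - a)).im

/-- The region `S₁`.  The lines `PFL` and `PFL / c` cut the plane into four closed sectors; the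
one that contains `ℓ₁` is `PH⁺ ∩ PH⁻ / c`.  The broken line from the midpoint `m₀` of `L₀`, which
is on `PFL`, through `ℓ₁` to the midpoint `m₁` of `L₁`, which is on `PFL / c`, cuts this sector
into a bounded and an unbounded part, and `S₁` is the closed unbounded part.  As
`ℓ₀, ℓ₁, ℓ₂, …` turns clockwise, the bounded part is the part strictly on the right of both
directed lines `ℓ₀ ℓ₁` and `ℓ₁ ℓ₂`, so the unbounded part consists of the points that are
on the left of (or on) one of them. -/
def S1 (c : ℂ) : Set ℂ :=
  {z | z ∈ PHplus c ∧ c * z ∈ PHminus c ∧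
    (OnLeft (ell c 0) (ell c 1) z ∨ OnLeft (ell c 1) (ell c 2) z)}

/-- `Sreg c k` is the region `S_{k+1}`, where `S_{k+1} = (S_k / c) ∩ PH⁺`. -/
def Sreg (c : ℂ) : ℕ → Set ℂ
  | 0 => S1 c
  | k + 1 => {z | c * z ∈ Sreg c k} ∩ PHplus c

/-- `S`, the union of all `S_k` with `k ≥ 1`. -/
def S (c : ℂ) : Set ℂ := ⋃ k : ℕ, Sreg c k

/-- The perimeter set `P`: the complement of the interior of `S ∪ S'`, where `S'` is the mirror
image of `S` in the pre-folding line. -/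
def P (c : ℂ) : Set ℂ := (interior (S c ∪ reflPFL c '' S c))ᶜ

/-- `ζ` is the first intersection of the spiral `L` with the pre-folding line: it lies on `L_n`, where `n` is the smallest positive
integer such that `L_n` meets the pre-folding line. -/
def IsZeta (c : ℂ) (n : ℕ) (ζ : ℂ) : Prop :=
  IsLeast {k : ℕ | 0 < k ∧ (Lseg c k ∩ PFL c).Nonempty} n ∧ ζ ∈ Lseg c n ∩ PFL c

/-- The outer-most boundary of `P` when `ζ` exists and lies on `L_n`. -/
def outerBoundary (c : ℂ) (n : ℕ) (ζ : ℂ) : Set ℂ :=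
  segment ℝ (ell c n) ζ ∪ segment ℝ (ell c (-((n : ℤ) - 1))) ζ ∪
    ⋃ k ∈ {k : ℤ | |k| ≤ (n : ℤ) - 1}, Lseg c k

/-- A simple closed polygonal curve: at least three vertices, all distinct, and two different
edges have no points in common except common end points. -/
def IsSimplePolygon {N : ℕ} (Q : Polygon ℂ N) : Prop :=
  3 ≤ N ∧ Function.Injective Q.vertices ∧
    ∀ i j : Fin N, i ≠ j → Q.edgeSet ℝ i ∩ Q.edgeSet ℝ j ⊆
      {Q.vertices i, Q.vertices (finRotate N i)} ∩ {Q.vertices j, Q.vertices (finRotate N j)}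

/-- `X` is the (closed, solid) polygon bounded by `B`: `B` is a simple closed polygonal curve, and
`X` consists of `B` and the points enclosed by it, i.e. those in a bounded connected component of
the complement of `B`. -/
def IsPolygonBoundedBy (X B : Set ℂ) : Prop :=
  (∃ (N : ℕ) (Q : Polygon ℂ N), IsSimplePolygon Q ∧ Q.boundary ℝ = B) ∧
    X = B ∪ {z | z ∉ B ∧ Bornology.IsBounded (connectedComponentIn Bᶜ z)}

end

end TTM

/-!
Write `R = |c|²` and `τ = 2 Im c / (R - 1)`. The line through `L_k` (`k ≥ 0`) is
`Re (c ^ (k + 1) z) = -τ`, with the same constant for every `k`, and multiplication by `c` carries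
it to the line through `L_{k-1}`. Fold the plane along the pre-folding line into `PH⁺` (the map
`up`); then `f z = c * up z`, and everything reduces to one convex polygon above the folding line,
`halfImage`, bounded by that line and by `c L_0, …, c L_n`. It is convex even when `P`
itself is not (`P` may have a reflex angle at `ζ`). The proof shows `P = f⁻¹ (halfImage) = K`.

Position of the vertices. Comparing `|γ₀| ≤ |ζ| ≤ |ℓ_n|` gives `R ^ n (R - 1)² ≤ 4 (Im c)²`
(`Crossing.growth_bound`). Hence the lines of the spiral up to `L_n` are no closer to `0` than
the pre-folding line, which forces the spiral to reach that line before it has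
turned by `3π/2` (`Crossing.turn_lt`). With this bound on the turning, the sums of
`Im (c ^ i)` that measure the position of a vertex relative to a line first increase and then
decrease, and so are positive because they are positive at the end (`pos_of_increments`): each
vertex is strictly inside all lines but the two through it. If `n ≥ 2`, then also `R ≤ 2` and
`Re c ≥ -1`, which put the images of `m_0` and the point `γ₀ / c` on the boundary of `P` and on
the segment `[m_0, ζ]` respectively.

Invariance. `f` maps `halfImage` into itself (`Crossing.f_mem`): every bound needed is for a
linear functional on a planar region that is a nonnegative combination of two of the constraints,
and so takes its minimum at a known vertex. This gives `f⁻¹ (halfImage) ⊆ K`.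

Escape. A point outside `halfImage` remains outside until its next fold, and then lies beyond one of
the first two lines, those of `L_0` and `L_1` (`Crossing.lt_or_lt_of_not_mem`). From then on `f`
maps the points beyond one of these lines to points beyond the other one, by a margin that grows
by the factor `|c|` at every step (`Beyond.image`). So the complement is disjoint from
`K`, and it is covered by `S ∪ S'`. Conversely a point of `S` with `f z ∈ halfImage` lies on
one of countably many lines, so that no interior point of `S ∪ S'` is in `f⁻¹ (halfImage)`.

Finally, strict convexity of `halfImage` yields that its edges, divided by `c`, and their mirror
images form a simple closed polygon; the points off the curve split into the open polygon, which is
bounded, and the complement of `P`, which contains with each point the ray from that point away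
from `m_0`.
-/

namespace TTM

open Complex

/-! ### The map, the folds and the spiral in coordinates -/

/-- The distance parameter of the spiral: for `k ≥ 0` the line through `L_k` is
`Re (c ^ (k + 1) * z) = -tau c`, with one and the same constant for all `k`. -/
noncomputable def tau (c : ℂ) : ℝ := 2 * c.im / (normSq c - 1)

/-- The points `ℓ_k` of the inward spiral, indexed by natural numbers. -/
noncomputable def spiralPt (c : ℂ) (k : ℕ) : ℂ := ell0 c / c ^ k

/-- The fold in the pre-folding line: of `z` and its mirror image, the one in `PH⁺`. -/
noncomputable def up (c z : ℂ) : ℂ := if -1 ≤ (c * z).im then z else reflPFL c z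

theorem one_lt_normSq {c : ℂ} (hc : 1 < ‖c‖) : 1 < normSq c := by
  rw [normSq_eq_norm_sq]; nlinarith

theorem ne_zero_of_one_lt {c : ℂ} (hc : 1 < ‖c‖) : c ≠ 0 := by
  rintro rfl; simp at hc; linarith

theorem tau_mul {c : ℂ} (hc : 1 < ‖c‖) : tau c * (normSq c - 1) = 2 * c.im := by
  have := one_lt_normSq hc
  rw [tau, div_mul_cancel₀]; linarith

theorem tau_pos {c : ℂ} (hc : 1 < ‖c‖) (him : 0 < c.im) : 0 < tau c := by
  have := one_lt_normSq hc
  exact div_pos (by linarith) (by linarith)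

theorem ell0_eq (c : ℂ) :
    ell0 c = ⟨-tau c, 2 * (1 - c.re) / (normSq c - 1)⟩ := by
  have : ell0 c = 2 * I * (1 - (starRingEnd ℂ) c) / ((normSq c - 1 : ℝ) : ℂ) := by
    rw [ell0, normSq_eq_norm_sq]
  rw [this]
  apply Complex.ext
  · rw [div_ofReal_re]; simp [tau]; ring
  · rw [div_ofReal_im]; simp

theorem ell0_re (c : ℂ) : (ell0 c).re = -tau c := by rw [ell0_eq]

theorem ell0_im (c : ℂ) : (ell0 c).im = 2 * (1 - c.re) / (normSq c - 1) := by rw [ell0_eq]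

theorem c_mul_ell0_re {c : ℂ} (hc : 1 < ‖c‖) : (c * ell0 c).re = -tau c := by
  have hne : normSq c - 1 ≠ 0 := by linarith [one_lt_normSq hc]
  rw [mul_re, ell0_re, ell0_im, tau]
  field_simp
  ring

theorem neg_one_lt_ell0_im {c : ℂ} (hc : 1 < ‖c‖) (him : 0 < c.im) : -1 < (ell0 c).im := by
  have := one_lt_normSq hc
  rw [ell0_im, lt_div_iff₀ (by linarith), normSq_apply]
  nlinarith [sq_nonneg (c.re - 1)]

theorem c_mul_ell0_im_lt {c : ℂ} (hc : 1 < ‖c‖) (him : 0 < c.im) : (c * ell0 c).im < -1 := by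
  have h1 := one_lt_normSq hc
  have : (c * ell0 c).im = 2 * (c.re - normSq c) / (normSq c - 1) := by
    rw [mul_im, ell0_re, ell0_im, tau, normSq_apply] at *
    field_simp
    ring
  rw [this, div_lt_iff₀ (by linarith), normSq_apply]
  nlinarith [sq_nonneg (c.re - 1)]

/-- The increments of `Re (c ^ m * ℓ₀)` in `m` have the sign of `Im (c ^ m)`. -/
theorem pow_mul_ell0_re_sub {c : ℂ} (hc : 1 < ‖c‖) (w : ℂ) :
    (w * c * ell0 c).re - (w * ell0 c).re =
      2 * (normSq c + 1 - 2 * c.re) / (normSq c - 1) * w.im := by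
  have := one_lt_normSq hc
  simp only [mul_re, mul_im, ell0_re, ell0_im, tau]
  field_simp
  simp only [normSq_apply]
  ring

theorem normSq_sub_one_pos {c : ℂ} (him : 0 < c.im) : 0 < normSq c + 1 - 2 * c.re := by
  rw [normSq_apply]; nlinarith [sq_nonneg (c.re - 1)]

theorem spiral_step_pos {c : ℂ} (hc : 1 < ‖c‖) (him : 0 < c.im) :
    0 < 2 * (normSq c + 1 - 2 * c.re) / (normSq c - 1) :=
  div_pos (by linarith [normSq_sub_one_pos him]) (by linarith [one_lt_normSq hc])

theorem spiralPt_zero (c : ℂ) : spiralPt c 0 = ell0 c := by simp [spiralPt]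

theorem mul_spiralPt_succ {c : ℂ} (hc : 1 < ‖c‖) (k : ℕ) :
    c * spiralPt c (k + 1) = spiralPt c k := by
  have := ne_zero_of_one_lt hc
  rw [spiralPt, spiralPt, pow_succ]; field_simp

theorem pow_mul_spiralPt {c : ℂ} (hc : 1 < ‖c‖) (m k : ℕ) :
    c ^ m * spiralPt c (m + k) = spiralPt c k := by
  induction m with
  | zero => simp
  | succ m ih =>
    rw [pow_succ, mul_assoc, show m + 1 + k = (m + k) + 1 by ring, mul_spiralPt_succ hc, ih]

theorem pow_mul_spiralPt' {c : ℂ} (hc : 1 < ‖c‖) (m k : ℕ) :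
    c ^ (m + k) * spiralPt c k = c ^ m * ell0 c := by
  rw [pow_add, mul_assoc]
  have := pow_mul_spiralPt hc k 0
  rw [add_zero, spiralPt_zero] at this; rw [this]

theorem norm_ell0_sq {c : ℂ} (hc : 1 < ‖c‖) :
    normSq (ell0 c) = 4 * (normSq c + 1 - 2 * c.re) / (normSq c - 1) ^ 2 := by
  have := one_lt_normSq hc
  have h : normSq (ell0 c) = (ell0 c).re * (ell0 c).re + (ell0 c).im * (ell0 c).im := normSq_apply _
  rw [h, ell0_re, ell0_im, tau]
  have e := normSq_apply c
  rw [neg_mul_neg, div_mul_div_comm, div_mul_div_comm, ← add_div, ← sq]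
  congr 1
  · rw [e]; ring
  · ring

theorem mem_PHplus_iff (c z : ℂ) : z ∈ PHplus c ↔ -1 ≤ (c * z).im := by
  simp only [PHplus, Set.mem_ofPred_eq, f]
  split_ifs with h
  · exact iff_of_true rfl h
  · simp only [h, iff_false]
    intro e
    have := congrArg Complex.im e
    simp at this h
    linarith

theorem mem_PHminus_iff (c z : ℂ) : z ∈ PHminus c ↔ (c * z).im ≤ -1 := by
  simp only [PHminus, Set.mem_ofPred_eq, f]
  split_ifs with h
  · constructor
    · intro e
      have := congrArg Complex.im e
      simp at this h ⊢
      linarith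
    · intro h'
      apply Complex.ext
      · simp
      · have : (c * z).im = -1 := le_antisymm h' h
        rw [sub_im, conj_im, this]; simp; norm_num
  · simp; simp at h; linarith

theorem mul_reflPFL {c : ℂ} (hc : 1 < ‖c‖) (z : ℂ) :
    c * reflPFL c z = (starRingEnd ℂ) (c * z) - 2 * I := by
  rw [reflPFL, mul_div_cancel₀ _ (ne_zero_of_one_lt hc)]

theorem mul_reflPFL_re {c : ℂ} (hc : 1 < ‖c‖) (z : ℂ) :
    (c * reflPFL c z).re = (c * z).re := by
  rw [mul_reflPFL hc]; simp

theorem mul_reflPFL_im {c : ℂ} (hc : 1 < ‖c‖) (z : ℂ) :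
    (c * reflPFL c z).im = -2 - (c * z).im := by
  rw [mul_reflPFL hc]; simp; ring

theorem eq_of_mul {c : ℂ} (hc : 1 < ‖c‖) {z w : ℂ} (h1 : (c * z).re = (c * w).re)
    (h2 : (c * z).im = (c * w).im) : z = w :=
  mul_left_cancel₀ (ne_zero_of_one_lt hc) (Complex.ext h1 h2)

theorem reflPFL_reflPFL {c : ℂ} (hc : 1 < ‖c‖) (z : ℂ) : reflPFL c (reflPFL c z) = z := by
  apply eq_of_mul hc
  · rw [mul_reflPFL_re hc, mul_reflPFL_re hc]
  · rw [mul_reflPFL_im hc, mul_reflPFL_im hc]; ring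

theorem reflPFL_eq_self {c : ℂ} (hc : 1 < ‖c‖) {z : ℂ} (h : (c * z).im = -1) :
    reflPFL c z = z := by
  apply eq_of_mul hc
  · rw [mul_reflPFL_re hc]
  · rw [mul_reflPFL_im hc, h]; ring

/-- `Re (c² z')` for the mirror image `z'` of `z` in the pre-folding line. -/
theorem sq_mul_reflPFL_re {c : ℂ} (hc : 1 < ‖c‖) (z : ℂ) :
    (c ^ 2 * reflPFL c z).re = normSq c * z.re + 2 * c.im := by
  rw [sq, mul_assoc, mul_reflPFL hc, normSq_apply]
  simp; ring

/-- `Im (c² z')` for the mirror image `z'` of `z` in the pre-folding line. -/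
theorem sq_mul_reflPFL_im {c : ℂ} (hc : 1 < ‖c‖) (z : ℂ) :
    (c ^ 2 * reflPFL c z).im = - normSq c * z.im - 2 * c.re := by
  rw [sq, mul_assoc, mul_reflPFL hc, normSq_apply]
  simp; ring

theorem f_eq_mul_up {c : ℂ} (hc : 1 < ‖c‖) (z : ℂ) : f c z = c * up c z := by
  unfold f up
  split_ifs
  · rfl
  · rw [mul_reflPFL hc]

theorem up_of_mem {c z : ℂ} (h : -1 ≤ (c * z).im) : up c z = z := if_pos h

theorem up_of_le {c : ℂ} (hc : 1 < ‖c‖) {z : ℂ} (h : (c * z).im ≤ -1) :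
    up c z = reflPFL c z := by
  unfold up
  split_ifs with h'
  · exact (reflPFL_eq_self hc (le_antisymm h h')).symm
  · rfl

theorem up_mem {c : ℂ} (hc : 1 < ‖c‖) (z : ℂ) : -1 ≤ (c * up c z).im := by
  rcases le_total (-1) (c * z).im with h | h
  · rwa [up_of_mem h]
  · rw [up_of_le hc h, mul_reflPFL_im hc]; linarith

theorem up_reflPFL {c : ℂ} (hc : 1 < ‖c‖) (z : ℂ) : up c (reflPFL c z) = up c z := by
  rcases le_total (-1) (c * z).im with h | h
  · rw [up_of_mem h, up_of_le hc, reflPFL_reflPFL hc]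
    rw [mul_reflPFL_im hc]; linarith
  · rw [up_of_le hc h, up_of_mem]
    rw [mul_reflPFL_im hc]; linarith

theorem continuous_reflPFL (c : ℂ) : Continuous (reflPFL c) := by
  unfold reflPFL; fun_prop

theorem continuous_up {c : ℂ} (hc : 1 < ‖c‖) : Continuous (up c) := by
  unfold up
  refine Continuous.if_le continuous_id (continuous_reflPFL c) continuous_const
    (by fun_prop) ?_
  intro x hx
  exact (reflPFL_eq_self hc hx.symm).symm

theorem ell_natCast (c : ℂ) (k : ℕ) : ell c k = spiralPt c k := by
  simp [ell, spiralPt]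

theorem reflPFL_ell_one {c : ℂ} (hc : 1 < ‖c‖) : reflPFL c (spiralPt c 1) = ell0 c := by
  have h1 : c * spiralPt c 1 = ell0 c := by rw [mul_spiralPt_succ hc 0, spiralPt_zero]
  apply eq_of_mul hc
  · rw [mul_reflPFL_re hc, h1, ell0_re, c_mul_ell0_re hc]
  · rw [mul_reflPFL_im hc, h1, mul_im, ell0_re, ell0_im, tau]
    have := one_lt_normSq hc
    have e := normSq_apply c
    have hne : normSq c - 1 ≠ 0 := by linarith
    field_simp
    linear_combination (-1) * e

theorem ell_neg (c : ℂ) (hc : 1 < ‖c‖) (k : ℕ) :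
    ell c (-(k : ℤ)) = reflPFL c (spiralPt c (k + 1)) := by
  rcases Nat.eq_zero_or_pos k with rfl | h
  · rw [zero_add, reflPFL_ell_one hc]; simp [ell]
  · rw [ell, if_neg (by omega), spiralPt]
    congr 2
    rw [neg_neg]; norm_cast

theorem mul_ell_one {c : ℂ} (hc : 1 < ‖c‖) : c * spiralPt c 1 = ell0 c := by
  rw [mul_spiralPt_succ hc 0, spiralPt_zero]

theorem spiralPt_succ_sub {c : ℂ} (hc : 1 < ‖c‖) (k : ℕ) :
    spiralPt c (k + 1) - spiralPt c k =
      ((2 * (normSq c + 1 - 2 * c.re) / (normSq c - 1) : ℝ) : ℂ) * I / c ^ (k + 1) := by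
  have h0 := ne_zero_of_one_lt hc
  have hne : normSq c - 1 ≠ 0 := by linarith [one_lt_normSq hc]
  have h1 : ell0 c - c * ell0 c =
      ((2 * (normSq c + 1 - 2 * c.re) / (normSq c - 1) : ℝ) : ℂ) * I := by
    apply Complex.ext
    · rw [sub_re, c_mul_ell0_re hc, ell0_re, re_ofReal_mul]; simp
    · rw [sub_im, mul_im, ell0_re, ell0_im]
      simp only [im_ofReal_mul, I_im, mul_one, tau]
      have e := normSq_apply c
      field_simp
      rw [e]; ring
  rw [← h1, spiralPt, spiralPt, div_sub' (pow_ne_zero _ h0),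
    div_eq_div_iff (pow_ne_zero _ h0) (pow_ne_zero _ h0), pow_succ]
  field_simp

theorem onLeft_iff {c : ℂ} (hc : 1 < ‖c‖) (him : 0 < c.im) (k : ℕ) (z : ℂ) :
    OnLeft (spiralPt c k) (spiralPt c (k + 1)) z ↔ (c ^ (k + 1) * z).re ≤ -tau c := by
  have h0 := ne_zero_of_one_lt hc
  have hR := one_lt_normSq hc
  have hst := spiral_step_pos hc him
  have hck : 0 < normSq (c ^ (k + 1)) := by rw [normSq_pos]; positivity
  set s := 2 * (normSq c + 1 - 2 * c.re) / (normSq c - 1) with hs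
  have hz : (c ^ (k + 1) * (z - spiralPt c k)).re = (c ^ (k + 1) * z).re + tau c := by
    rw [mul_sub, sub_re, add_comm k 1, pow_mul_spiralPt' hc 1 k, pow_one, c_mul_ell0_re hc]; ring
  have key : ((starRingEnd ℂ) (s * I / c ^ (k + 1)) * (z - spiralPt c k)).im =
      - (s / normSq (c ^ (k + 1)) * (c ^ (k + 1) * (z - spiralPt c k)).re) := by
    generalize c ^ (k + 1) = w at *
    generalize z - spiralPt c k = v
    rw [div_eq_mul_inv, Complex.inv_def]
    simp
    field_simp
    ring
  rw [OnLeft, spiralPt_succ_sub hc, ← hs, key, hz]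
  have : 0 < s / normSq (c ^ (k + 1)) := div_pos hst hck
  constructor
  · intro h
    by_contra! h'
    nlinarith [mul_pos this (show 0 < (c ^ (k + 1) * z).re + tau c by linarith)]
  · intro h
    nlinarith [mul_nonneg this.le (show 0 ≤ -((c ^ (k + 1) * z).re + tau c) by linarith)]

theorem mem_S1_iff {c : ℂ} (hc : 1 < ‖c‖) (him : 0 < c.im) (z : ℂ) :
    z ∈ S1 c ↔ -1 ≤ (c * z).im ∧ (c * (c * z)).im ≤ -1 ∧
      ((c * z).re ≤ -tau c ∨ (c ^ 2 * z).re ≤ -tau c) := by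
  have h0 := onLeft_iff hc him 0 z
  have h1 := onLeft_iff hc him 1 z
  have e0 : ell c 0 = spiralPt c 0 := ell_natCast c 0
  have e1 : ell c 1 = spiralPt c 1 := ell_natCast c 1
  have e2 : ell c 2 = spiralPt c 2 := ell_natCast c 2
  simp only [S1, Set.mem_ofPred_eq, mem_PHplus_iff, mem_PHminus_iff, e0, e1, e2]
  rw [spiralPt_zero, zero_add, pow_one] at h0
  rw [one_add_one_eq_two] at h1
  rw [spiralPt_zero, h0, h1]

/-! ### The first crossing and the turning angle of the spiral -/

/-- The spiral `ℓ_0, ℓ_1, …` crosses the folding line for the first time at `t - i`, on the segment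
`L_m = c L_{m+1}`. Thus `ζ = (t - i) / c` and `n = m + 1`; the field `low` says that
`Im ζ ≤ -1`. -/
structure Crossing (c : ℂ) (m : ℕ) (t : ℝ) : Prop where
  one_lt : 1 < ‖c‖
  im_pos : 0 < c.im
  above : ∀ k ≤ m, -1 < (spiralPt c k).im
  mem : (⟨t, -1⟩ : ℂ) ∈ segment ℝ (spiralPt c m) (spiralPt c (m + 1))
  low : normSq c - c.re ≤ c.im * t

theorem pow_re_eq (c : ℂ) (k : ℕ) : (c ^ k).re = ‖c‖ ^ k * Real.cos (k * arg c) := by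
  conv_lhs => rw [← norm_mul_exp_arg_mul_I c]
  rw [mul_pow, ← Complex.exp_nat_mul, ← ofReal_pow, re_ofReal_mul, ← mul_assoc,
    ← ofReal_natCast, ← ofReal_mul, exp_ofReal_mul_I_re]

theorem pow_im_eq (c : ℂ) (k : ℕ) : (c ^ k).im = ‖c‖ ^ k * Real.sin (k * arg c) := by
  conv_lhs => rw [← norm_mul_exp_arg_mul_I c]
  rw [mul_pow, ← Complex.exp_nat_mul, ← ofReal_pow, im_ofReal_mul, ← mul_assoc,
    ← ofReal_natCast, ← ofReal_mul, exp_ofReal_mul_I_im]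

theorem arg_pos_of_im {c : ℂ} (him : 0 < c.im) : 0 < arg c := by
  rcases (arg_nonneg_iff.2 him.le).lt_or_eq with h | h
  · exact h
  · rw [eq_comm, arg_eq_zero_iff] at h; linarith [h.2]

theorem arg_lt_pi_of_im {c : ℂ} (him : 0 < c.im) : arg c < Real.pi :=
  arg_lt_pi_iff.2 (Or.inr him.ne')

theorem spiralPt_succ_re_sub {c : ℂ} (hc : 1 < ‖c‖) (k : ℕ) :
    (spiralPt c (k + 1)).re - (spiralPt c k).re =
      2 * (normSq c + 1 - 2 * c.re) / (normSq c - 1) / normSq (c ^ (k + 1)) *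
        (c ^ (k + 1)).im := by
  rw [← sub_re, spiralPt_succ_sub hc, mul_div_assoc, re_ofReal_mul, div_eq_mul_inv I,
    Complex.inv_def]
  simp only [mul_re, mul_im, I_re, I_im, conj_re, conj_im, ofReal_re, ofReal_im]
  ring

theorem spiralPt_succ_im_sub {c : ℂ} (hc : 1 < ‖c‖) (k : ℕ) :
    (spiralPt c (k + 1)).im - (spiralPt c k).im =
      2 * (normSq c + 1 - 2 * c.re) / (normSq c - 1) / normSq (c ^ (k + 1)) *
        (c ^ (k + 1)).re := by
  rw [← sub_im, spiralPt_succ_sub hc, mul_div_assoc, im_ofReal_mul, div_eq_mul_inv I,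
    Complex.inv_def]
  simp only [mul_re, mul_im, I_re, I_im, conj_re, conj_im, ofReal_re, ofReal_im]
  ring

/-- A real linear functional `z ↦ Re (w z)` on a segment lies above a common lower bound of its
values at the end points. -/
theorem le_re_of_mem_segment {a b z w : ℂ} {s : ℝ} (hz : z ∈ segment ℝ a b)
    (ha : s ≤ (w * a).re) (hb : s ≤ (w * b).re) : s ≤ (w * z).re := by
  obtain ⟨p, q, hp, hq, hpq, rfl⟩ := hz
  have : (w * (p • a + q • b)).re = p * (w * a).re + q * (w * b).re := by
    simp; ring
  have hs : s = p * s + q * s := by rw [← add_mul, hpq, one_mul]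
  rw [this, hs]
  gcongr

theorem le_im_of_mem_segment {a b z : ℂ} {s : ℝ} (hz : z ∈ segment ℝ a b)
    (ha : s ≤ a.im) (hb : s ≤ b.im) : s ≤ z.im := by
  have := le_re_of_mem_segment (w := -I) (s := s) hz (by simpa using ha) (by simpa using hb)
  simpa using this

/-- A real linear functional `z ↦ Re (w z)` that takes the same value at two points is constant
on the segment. -/
theorem re_eq_of_mem_segment {a b z w : ℂ} {s : ℝ} (hz : z ∈ segment ℝ a b)
    (ha : (w * a).re = s) (hb : (w * b).re = s) : (w * z).re = s := by
  refine le_antisymm ?_ (le_re_of_mem_segment hz ha.ge hb.ge)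
  have := le_re_of_mem_segment (w := -w) (s := -s) hz (by simp [← ha]) (by simp [← hb])
  rw [neg_mul, neg_re] at this
  linarith

namespace Crossing

variable {c : ℂ} {m : ℕ} {t : ℝ}

theorem t_pos (h : Crossing c m t) : 0 < t := by
  have h1 := one_lt_normSq h.one_lt
  have h2 := h.low
  have h3 := h.im_pos
  have : c.re < normSq c := by
    rw [normSq_apply] at *; nlinarith [sq_nonneg (c.re - 1)]
  by_contra! h4
  nlinarith

theorem neg_tau_lt (h : Crossing c m t) : -tau c < t := by
  linarith [h.t_pos, tau_pos h.one_lt h.im_pos]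

/-- Comparison of the distances of `γ₀`, `ζ` and `ℓ_n` from the centre `0` of the spiral. -/
theorem growth_bound (h : Crossing c m t) :
    normSq c ^ (m + 1) * (normSq c - 1) ^ 2 ≤ 4 * c.im ^ 2 := by
  have hR := one_lt_normSq h.one_lt
  have hD := normSq_sub_one_pos h.im_pos
  have hb := h.im_pos
  have h0 := ne_zero_of_one_lt h.one_lt
  have hle : ‖(⟨t, -1⟩ : ℂ)‖ ≤ ‖spiralPt c m‖ := by
    have : (⟨t, -1⟩ : ℂ) ∈ Metric.closedBall (0 : ℂ) ‖spiralPt c m‖ := by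
      refine (convex_closedBall _ _).segment_subset ?_ ?_ h.mem
      · simp
      · rw [mem_closedBall_zero_iff, ← mul_spiralPt_succ h.one_lt m, norm_mul]
        exact le_mul_of_one_le_left (norm_nonneg _) h.one_lt.le
    simpa using this
  have hsq : t ^ 2 + 1 ≤ normSq (ell0 c) / normSq c ^ m := by
    have e1 : normSq (⟨t, -1⟩ : ℂ) = t ^ 2 + 1 := by rw [normSq_apply]; ring
    have e2 : normSq (spiralPt c m) = normSq (ell0 c) / normSq c ^ m := by
      rw [spiralPt, map_div₀, map_pow]
    rw [← e1, ← e2, normSq_eq_norm_sq, normSq_eq_norm_sq]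
    gcongr
  rw [norm_ell0_sq h.one_lt, div_div, le_div_iff₀ (by positivity)] at hsq
  have hlow : normSq c * (normSq c + 1 - 2 * c.re) ≤ c.im ^ 2 * (t ^ 2 + 1) := by
    have h1 := h.low
    have h2 : 0 ≤ normSq c - c.re := by
      rw [normSq_apply] at *; nlinarith [sq_nonneg (c.re - 1)]
    have h3 : (normSq c - c.re) ^ 2 ≤ (c.im * t) ^ 2 := by gcongr
    have e := normSq_apply c
    nlinarith
  have hpos : 0 ≤ (normSq c - 1) ^ 2 * normSq c ^ m := by positivity
  have h5 : normSq c * (normSq c + 1 - 2 * c.re) * ((normSq c - 1) ^ 2 * normSq c ^ m) ≤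
      c.im ^ 2 * (4 * (normSq c + 1 - 2 * c.re)) := by
    calc _ ≤ c.im ^ 2 * (t ^ 2 + 1) * ((normSq c - 1) ^ 2 * normSq c ^ m) := by gcongr
      _ = c.im ^ 2 * ((t ^ 2 + 1) * ((normSq c - 1) ^ 2 * normSq c ^ m)) := by ring
      _ ≤ _ := by gcongr
  have h6 : (normSq c + 1 - 2 * c.re) * (normSq c ^ (m + 1) * (normSq c - 1) ^ 2) ≤
      (normSq c + 1 - 2 * c.re) * (4 * c.im ^ 2) := by
    rw [pow_succ]; linarith
  exact le_of_mul_le_mul_left h6 hD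

theorem norm_pow_le_tau (h : Crossing c m t) {k : ℕ} (hk : k ≤ m + 1) : ‖c‖ ^ k ≤ tau c := by
  have hR := one_lt_normSq h.one_lt
  have h1 := h.growth_bound
  have h2 : ‖c‖ ^ k ≤ ‖c‖ ^ (m + 1) := pow_le_pow_right₀ h.one_lt.le hk
  refine h2.trans ?_
  rw [tau, le_div_iff₀ (by linarith)]
  refine le_of_sq_le_sq ?_ (by linarith [h.im_pos])
  rw [mul_pow, ← pow_mul, mul_comm (m + 1) 2, pow_mul, ← normSq_eq_norm_sq]
  linarith

theorem spiralPt_succ_im_le (h : Crossing c m t) : (spiralPt c (m + 1)).im ≤ -1 := by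
  by_contra! h'
  have h2 := h.above m le_rfl
  have h3 : min (spiralPt c m).im (spiralPt c (m + 1)).im ≤ (⟨t, -1⟩ : ℂ).im :=
    le_im_of_mem_segment h.mem (min_le_left _ _) (min_le_right _ _)
  exact absurd h3 (not_le.2 (lt_min h2 h'))

theorem pow_re_neg (h : Crossing c m t) : (c ^ (m + 1)).re < 0 := by
  have h1 := spiralPt_succ_im_sub h.one_lt m
  have h2 := h.spiralPt_succ_im_le
  have h3 := h.above m le_rfl
  have h4 : 0 < normSq (c ^ (m + 1)) := by
    rw [normSq_pos]; exact pow_ne_zero _ (ne_zero_of_one_lt h.one_lt)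
  have h5 := div_pos (spiral_step_pos h.one_lt h.im_pos) h4
  by_contra! h6
  nlinarith [mul_nonneg h5.le h6]

/-- The spiral meets the pre-folding line before it has turned by three right angles. Otherwise
two consecutive lines of the spiral, both at distance at least `1` from `0` after scaling by `c`,
would have outer normals on either side of `-i`, and their intersection would lie below the
folding line. -/
theorem turn_lt (h : Crossing c m t) : ((m + 1 : ℕ) : ℝ) * arg c < 3 * Real.pi / 2 := by
  by_contra! hcon
  have hth := arg_pos_of_im h.im_pos
  have hth' := arg_lt_pi_of_im h.im_pos
  have hpi := Real.pi_pos
  classical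
  have hex : ∃ k : ℕ, 3 * Real.pi / 2 ≤ (k : ℝ) * arg c := ⟨_, hcon⟩
  set k := Nat.find hex with hk
  have hk1 : 3 * Real.pi / 2 ≤ (k : ℝ) * arg c := Nat.find_spec hex
  have hkm : k ≤ m + 1 := Nat.find_min' hex hcon
  obtain ⟨j, hj⟩ : ∃ j, k = j + 1 := by
    refine Nat.exists_eq_succ_of_ne_zero fun h0 => ?_
    rw [h0] at hk1; simp at hk1; linarith
  have hk2 : (j : ℝ) * arg c < 3 * Real.pi / 2 := by
    by_contra! h'
    have : k ≤ j := Nat.find_min' hex h'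
    omega
  rw [hj] at hk1 hkm
  have hjm : j ≤ m := by omega
  have hab := h.above j hjm
  set v := spiralPt c j with hv
  have e1 : (c ^ (j + 1) * v).re = -tau c := by
    rw [add_comm, pow_mul_spiralPt' h.one_lt 1 j, pow_one, c_mul_ell0_re h.one_lt]
  have e2 : (c ^ j * v).re = -tau c := by
    have := pow_mul_spiralPt' h.one_lt 0 j
    rw [zero_add, pow_zero, one_mul] at this
    rw [this, ell0_re]
  have ht := h.norm_pow_le_tau hkm
  have hr : 0 < ‖c‖ := by linarith [h.one_lt]
  push_cast at hk1
  set A := ((j : ℝ) + 1) * arg c - 3 * Real.pi / 2 with hA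
  set B := 3 * Real.pi / 2 - (j : ℝ) * arg c with hB
  have hAB : A + B = arg c := by rw [hA, hB]; ring
  have hA0 : 0 ≤ A := by linarith
  have hB0 : 0 < B := by linarith
  have hsA : 0 ≤ Real.sin A := Real.sin_nonneg_of_nonneg_of_le_pi hA0 (by linarith)
  have hsB : 0 ≤ Real.sin B := Real.sin_nonneg_of_nonneg_of_le_pi hB0.le (by linarith)
  have hsum : Real.sin (arg c) ≤ Real.sin A + Real.sin B := by
    rw [← hAB, Real.sin_add]
    nlinarith [Real.cos_le_one A, Real.cos_le_one B]
  have hst : 0 < Real.sin (arg c) := Real.sin_pos_of_pos_of_lt_pi hth hth'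
  -- `Re` and `Im` of the powers through the angles `A` and `B`
  have cA : Real.cos ((j + 1 : ℝ) * arg c) = Real.sin A := by
    rw [hA, show ((j : ℝ) + 1) * arg c - 3 * Real.pi / 2 =
      ((j : ℝ) + 1) * arg c + Real.pi / 2 - 2 * Real.pi by ring, Real.sin_sub_two_pi,
      Real.sin_add_pi_div_two]
  have sA : Real.sin ((j + 1 : ℝ) * arg c) = -Real.cos A := by
    rw [hA, show ((j : ℝ) + 1) * arg c - 3 * Real.pi / 2 =
      ((j : ℝ) + 1) * arg c + Real.pi / 2 - 2 * Real.pi by ring, Real.cos_sub_two_pi,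
      Real.cos_add_pi_div_two, neg_neg]
  have cB : Real.cos ((j : ℝ) * arg c) = -Real.sin B := by
    rw [hB, show 3 * Real.pi / 2 - (j : ℝ) * arg c =
      (Real.pi / 2 - (j : ℝ) * arg c) + Real.pi by ring, Real.sin_add_pi,
      Real.sin_pi_div_two_sub, neg_neg]
  have sB : Real.sin ((j : ℝ) * arg c) = -Real.cos B := by
    rw [hB, show 3 * Real.pi / 2 - (j : ℝ) * arg c =
      (Real.pi / 2 - (j : ℝ) * arg c) + Real.pi by ring, Real.cos_add_pi,
      Real.cos_pi_div_two_sub, neg_neg]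
  rw [mul_re, pow_re_eq, pow_im_eq] at e1 e2
  push_cast at e1
  rw [cA, sA] at e1
  rw [cB, sB] at e2
  have hrj : 0 < ‖c‖ ^ j := by positivity
  have hrj1 : 0 < ‖c‖ ^ (j + 1) := by positivity
  have f1 : Real.sin A * v.re + Real.cos A * v.im = -(tau c / ‖c‖ ^ (j + 1)) := by
    rw [eq_comm, ← neg_div, div_eq_iff hrj1.ne', ← e1]; ring
  have f2 : -Real.sin B * v.re + Real.cos B * v.im = -(tau c / ‖c‖ ^ j) := by
    rw [eq_comm, ← neg_div, div_eq_iff hrj.ne', ← e2]; ring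
  have g1 : 1 ≤ tau c / ‖c‖ ^ (j + 1) := by rwa [le_div_iff₀ hrj1, one_mul]
  have g2 : 1 ≤ tau c / ‖c‖ ^ j := by
    rw [le_div_iff₀ hrj, one_mul]; exact h.norm_pow_le_tau (by omega)
  have key : Real.sin (arg c) * v.im =
      -(Real.sin B * (tau c / ‖c‖ ^ (j + 1)) + Real.sin A * (tau c / ‖c‖ ^ j)) := by
    rw [← hAB, Real.sin_add]
    linear_combination Real.sin B * f1 + Real.sin A * f2
  nlinarith [mul_le_mul_of_nonneg_left g1 hsB, mul_le_mul_of_nonneg_left g2 hsA,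
    mul_lt_mul_of_pos_left hab hst]

theorem lt_turn (h : Crossing c m t) : Real.pi / 2 < ((m + 1 : ℕ) : ℝ) * arg c := by
  by_contra! h'
  have h1 := h.pow_re_neg
  rw [pow_re_eq] at h1
  have h2 : 0 ≤ Real.cos (((m + 1 : ℕ) : ℝ) * arg c) := by
    apply Real.cos_nonneg_of_neg_pi_div_two_le_of_le _ h'
    have := arg_pos_of_im h.im_pos
    have : 0 ≤ ((m + 1 : ℕ) : ℝ) * arg c := by positivity
    linarith [Real.pi_pos]
  have h3 : 0 < ‖c‖ ^ (m + 1) := pow_pos (by linarith [h.one_lt]) _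
  nlinarith

/-- For a crossing after the first segment, `c` lies in the disc `|c|² ≤ 2`, so that `f` maps the
midpoint of `L_0` into `L_{-1}`. -/
theorem normSq_le_two (h : Crossing c m t) (hm : 1 ≤ m) : normSq c ≤ 2 := by
  by_contra! hR
  have hg := h.growth_bound
  have e := normSq_apply c
  rcases Nat.lt_or_ge 1 m with hm2 | hm1
  · have h1 : normSq c ^ 3 ≤ normSq c ^ (m + 1) :=
      pow_le_pow_right₀ (by linarith) (by omega)
    have h2 : normSq c ^ 3 * (normSq c - 1) ^ 2 ≤ 4 * c.im ^ 2 :=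
      (mul_le_mul_of_nonneg_right h1 (sq_nonneg _)).trans hg
    have h3 : 4 * c.im ^ 2 ≤ 4 * normSq c := by nlinarith [sq_nonneg c.re]
    have h4 : 4 < normSq c ^ 2 := by nlinarith
    have h5 : 1 ≤ (normSq c - 1) ^ 2 := by nlinarith
    have h6 : 4 < normSq c ^ 2 * (normSq c - 1) ^ 2 := by nlinarith
    nlinarith
  · obtain rfl : m = 1 := by omega
    have hb := h.im_pos
    set R := normSq c with hRdef
    have hne : R - 1 ≠ 0 := by linarith
    have hD := normSq_sub_one_pos h.im_pos
    rw [← hRdef] at hD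
    -- the end point `ℓ_2` is not above the folding line
    have hi : R ^ 2 - 2 * R + 2 * c.re * R + 4 * c.re ^ 2 ≤ 0 := by
      have h1 := h.spiralPt_succ_im_le
      have h2 : (spiralPt c (1 + 1)).im * ((R - 1) * R ^ 2) =
          4 * c.re ^ 2 - 2 * R + 6 * c.re * R - 8 * c.re ^ 3 +
            (c.im ^ 2 - (R - c.re ^ 2)) * (6 * c.re - 2) := by
        rw [spiralPt, div_eq_mul_inv, Complex.inv_def, ell0_eq]
        have h0 : R ≠ 0 := by linarith
        simp only [map_pow, mul_im, tau, ← hRdef, ofReal_re, ofReal_im, mul_re]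
        simp only [one_add_one_eq_two, sq ((starRingEnd ℂ) c), mul_re, mul_im, conj_re, conj_im]
        field_simp
        rw [e]
        ring
      have h3 : c.im ^ 2 - (R - c.re ^ 2) = 0 := by rw [e]; ring
      rw [h3] at h2
      have h4 : 0 < (R - 1) * R ^ 2 := by
        have : 0 < R - 1 := by linarith
        positivity
      have h5 : (R + 1 - 2 * c.re) * (R ^ 2 - 2 * R + 2 * c.re * R + 4 * c.re ^ 2) ≤ 0 := by
        nlinarith
      by_contra! h6
      nlinarith [mul_pos hD h6]
    have ha : c.re < 0 := by
      by_contra! ha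
      nlinarith [mul_nonneg ha (by linarith : 0 ≤ R)]
    have ha1 : -1 ≤ c.re := by
      by_contra! ha
      nlinarith [sq_nonneg (R - 1 + c.re)]
    -- the equation of the line through `L_2` at the crossing
    have hline : (c ^ 2 * (⟨t, -1⟩ : ℂ)).re = -tau c := by
      refine re_eq_of_mem_segment h.mem ?_ ?_
      · rw [show (2 : ℕ) = 1 + 1 from rfl, pow_mul_spiralPt' h.one_lt 1 1, pow_one,
          c_mul_ell0_re h.one_lt]
      · have := pow_mul_spiralPt' h.one_lt 0 2
        rw [zero_add, pow_zero, one_mul] at this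
        rw [one_add_one_eq_two, this, ell0_re]
    have hl : t * (c.im ^ 2 - c.re ^ 2) * (R - 1) = 2 * c.im + 2 * c.re * c.im * (R - 1) := by
      have h1 := tau_mul h.one_lt
      rw [← hRdef] at h1
      rw [sq, mul_re, mul_re, mul_im] at hline
      simp only at hline
      linear_combination (-(R - 1)) * hline + h1
    have hlow := h.low
    rw [← hRdef] at hlow
    set a := -c.re with hadef
    have hca : c.re = -a := by rw [hadef]; ring
    rw [hca] at *
    have hb2 : c.im ^ 2 = R - a ^ 2 := by rw [e]; ring
    have hpos : 0 < R - 2 * a ^ 2 := by nlinarith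
    have k1 : (R + a) * ((R - 2 * a ^ 2) * (R - 1)) ≤ 2 * (R - a ^ 2) * (1 + a - a * R) := by
      have : c.im * t * ((R - 2 * a ^ 2) * (R - 1)) = 2 * (R - a ^ 2) * (1 + a - a * R) := by
        rw [← hb2]
        linear_combination c.im * hl + c.im * t * (R-1) * (-1) * hb2
      rw [← this]
      refine mul_le_mul_of_nonneg_right (by linarith) ?_
      exact mul_nonneg hpos.le (by linarith)
    have k2 : (R + 1 + 2 * a) * (R ^ 2 - 2 * R + a * R - 2 * R * a ^ 2 + 2 * a ^ 2) ≤ 0 := by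
      nlinarith
    have k3 : 0 < R ^ 2 - 2 * R + a * R - 2 * R * a ^ 2 + 2 * a ^ 2 := by
      have i1 : 0 < R + a - 2 * a ^ 2 := by nlinarith
      nlinarith [mul_pos (by linarith : 0 < R - 2) i1,
        mul_nonneg (by linarith : 0 ≤ a) (by linarith : 0 ≤ 1 - a)]
    nlinarith [mul_pos (by linarith : 0 < R + 1 + 2 * a) k3]

theorem neg_one_le_re (h : Crossing c m t) (hm : 1 ≤ m) : -1 ≤ c.re := by
  have h2 := h.normSq_le_two hm
  have h1 := h.above 1 hm
  have hR := one_lt_normSq h.one_lt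
  have e := normSq_apply c
  set R := normSq c with hRdef
  have hne : R - 1 ≠ 0 := by linarith
  have h0 : R ≠ 0 := by linarith
  have h3 : (spiralPt c 1).im * ((R - 1) * R) = 2 * (c.re + R - 2 * c.re ^ 2) := by
    rw [spiralPt, div_eq_mul_inv, Complex.inv_def, ell0_eq, pow_one]
    simp only [mul_im, tau, ← hRdef, ofReal_re, ofReal_im, mul_re, conj_re, conj_im]
    field_simp
    rw [e]
    ring
  have h4 : 0 < (R - 1) * R := mul_pos (by linarith) (by linarith)
  have h5 : 0 < (R + 1 - 2 * c.re) * (R + 2 * c.re) := by nlinarith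
  have hD := normSq_sub_one_pos h.im_pos
  have h6 := pos_of_mul_pos_right h5 hD.le
  linarith

end Crossing

/-! ### The convex polygon `f (P)` and its vertices -/

/-- The convex polygon that the map makes of the part of `P` in `PH⁺`: it is bounded by the
folding line and by the images `c L_0, …, c L_{m+1}`, that is, by the lines
`Re (c ^ k * w) = -tau c` with `k ≤ m + 1`. -/
def halfImage (c : ℂ) (m : ℕ) : Set ℂ :=
  {w | -1 ≤ w.im ∧ ∀ k ≤ m + 1, -tau c ≤ (c ^ k * w).re}

theorem convex_halfImage (c : ℂ) (m : ℕ) : Convex ℝ (halfImage c m) := by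
  rw [convex_iff_segment_subset]
  intro x hx y hy z hz
  exact ⟨le_im_of_mem_segment hz hx.1 hy.1,
    fun k hk => le_re_of_mem_segment hz (hx.2 k hk) (hy.2 k hk)⟩

theorem isClosed_halfImage (c : ℂ) (m : ℕ) : IsClosed (halfImage c m) := by
  have : halfImage c m = {w : ℂ | -1 ≤ w.im} ∩ ⋂ k ≤ m + 1, {w : ℂ | -tau c ≤ (c ^ k * w).re} := by
    ext w; simp [halfImage]
  rw [this]
  refine (isClosed_le continuous_const continuous_im).inter ?_
  refine isClosed_iInter fun k => isClosed_iInter fun _ => isClosed_le continuous_const ?_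
  fun_prop

/-- A sequence that starts at `0`, whose increments have the signs of `sin θ, sin 2θ, …`, is
positive as long as the angle is at most `π`, and then up to any index where it is positive. -/
theorem pos_of_increments {c : ℂ} (hc : 1 < ‖c‖) (him : 0 < c.im) {m : ℕ}
    (hturn : ((m + 1 : ℕ) : ℝ) * arg c < 3 * Real.pi / 2) {a C : ℕ → ℝ} (h0 : a 0 = 0)
    (hC : ∀ i, 0 < C i) (ha : ∀ i, a (i + 1) - a i = C i * (c ^ (i + 1)).im)
    (hm : Real.pi < ((m + 1 : ℕ) : ℝ) * arg c → 0 < a m) {i : ℕ} (hi : 1 ≤ i) (him' : i ≤ m) :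
    0 < a i := by
  have hth := arg_pos_of_im him
  have hpi := Real.pi_pos
  have hr : 0 < ‖c‖ := by linarith
  rcases le_or_gt ((i : ℝ) * arg c) Real.pi with h | h
  · clear hm him'
    induction i, hi using Nat.le_induction with
    | base =>
      have := ha 0
      rw [h0, zero_add, pow_one] at this
      nlinarith [mul_pos (hC 0) him]
    | succ i hi ih =>
      have h1 : (i : ℝ) * arg c ≤ Real.pi := by
        push_cast at h; linarith
      have h2 : 0 ≤ (c ^ (i + 1)).im := by
        rw [pow_im_eq]
        exact mul_nonneg (by positivity) (Real.sin_nonneg_of_nonneg_of_le_pi (by positivity) h)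
      nlinarith [ih h1, ha i, mul_nonneg (hC i).le h2]
  · have hmono : ∀ j, i ≤ j → j ≤ m → a j ≤ a i := by
      intro j hij
      induction j, hij using Nat.le_induction with
      | base => intro _; exact le_rfl
      | succ j hij ih =>
        intro hjm
        refine le_trans ?_ (ih (by omega))
        have h1 : (i : ℝ) * arg c ≤ ((j + 1 : ℕ) : ℝ) * arg c := by
          gcongr; omega
        have h2 : ((j + 1 : ℕ) : ℝ) * arg c ≤ ((m + 1 : ℕ) : ℝ) * arg c := by
          gcongr; omega
        have h3 : (c ^ (j + 1)).im ≤ 0 := by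
          rw [pow_im_eq]
          refine mul_nonpos_of_nonneg_of_nonpos (by positivity) ?_
          have := Real.sin_nonneg_of_nonneg_of_le_pi
            (x := ((j + 1 : ℕ) : ℝ) * arg c - Real.pi) (by linarith) (by linarith)
          rw [Real.sin_sub_pi] at this
          linarith
        nlinarith [ha j, mul_nonneg (hC j).le (neg_nonneg.2 h3)]
    have h1 : (i : ℝ) * arg c ≤ ((m + 1 : ℕ) : ℝ) * arg c := by
      gcongr; omega
    exact (hm (by linarith)).trans_le (hmono m him' le_rfl)

/-- The midpoint of `c L_0` is on the folding line. -/
theorem mid_eq {c : ℂ} (hc : 1 < ‖c‖) :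
    (⟨-tau c, -1⟩ : ℂ) = (1 / 2 : ℝ) • (ell0 c + c * ell0 c) := by
  apply Complex.ext
  · rw [real_smul, re_ofReal_mul, add_re, ell0_re, c_mul_ell0_re hc]; ring
  · rw [real_smul, im_ofReal_mul, add_im, mul_im, ell0_re, ell0_im, tau]
    have hne : normSq c - 1 ≠ 0 := by linarith [one_lt_normSq hc]
    have e := normSq_apply c
    field_simp
    linear_combination (-1) * e

namespace Crossing

variable {c : ℂ} {m : ℕ} {t : ℝ}

theorem last_line (h : Crossing c m t) : (c ^ (m + 1) * (⟨t, -1⟩ : ℂ)).re = -tau c := by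
  refine re_eq_of_mem_segment h.mem ?_ ?_
  · rw [add_comm, pow_mul_spiralPt' h.one_lt 1 m, pow_one, c_mul_ell0_re h.one_lt]
  · have := pow_mul_spiralPt' h.one_lt 0 (m + 1)
    rw [zero_add, pow_zero, one_mul] at this
    rw [this, ell0_re]

theorem last_line_mid (h : Crossing c m t) :
    -tau c < (c ^ (m + 1) * (⟨-tau c, -1⟩ : ℂ)).re := by
  have h1 := h.last_line
  have h2 := h.pow_re_neg
  have h3 := h.neg_tau_lt
  rw [mul_re] at h1 ⊢
  simp only at h1 ⊢
  nlinarith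

theorem pow_im_nonpos (h : Crossing c m t)
    (hpi : Real.pi < ((m + 1 : ℕ) : ℝ) * arg c) : (c ^ (m + 1)).im ≤ 0 := by
  have hr : 0 < ‖c‖ := by linarith [h.one_lt]
  have := h.turn_lt
  rw [pow_im_eq]
  refine mul_nonpos_of_nonneg_of_nonpos (by positivity) ?_
  have := Real.sin_nonneg_of_nonneg_of_le_pi
    (x := ((m + 1 : ℕ) : ℝ) * arg c - Real.pi) (by linarith) (by linarith [Real.pi_pos])
  rw [Real.sin_sub_pi] at this
  linarith

/-- Lines further in along the spiral leave earlier vertices strictly on their inner side. -/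
theorem outer_pos (h : Crossing c m t) {i : ℕ} (hi : 1 ≤ i) (him : i ≤ m) :
    -tau c < (c ^ (i + 1) * ell0 c).re := by
  have := pos_of_increments h.one_lt h.im_pos h.turn_lt
    (a := fun i => (c ^ (i + 1) * ell0 c).re + tau c)
    (C := fun _ => 2 * (normSq c + 1 - 2 * c.re) / (normSq c - 1))
    (by simp only [zero_add, pow_one]; rw [c_mul_ell0_re h.one_lt]; ring)
    (fun _ => spiral_step_pos h.one_lt h.im_pos)
    (fun i => by
      have := pow_mul_ell0_re_sub h.one_lt (c ^ (i + 1))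
      rw [← pow_succ] at this
      linarith)
    (fun hpi => by
      have h1 := h.last_line_mid
      have h2 := h.pow_im_nonpos hpi
      have h3 := neg_one_lt_ell0_im h.one_lt h.im_pos
      rw [mul_re] at h1 ⊢
      rw [ell0_re]
      simp only at h1 ⊢
      nlinarith)
    hi him
  linarith

/-- Lines of the spiral leave later vertices strictly on their inner side. -/
theorem inner_pos (h : Crossing c m t) {i : ℕ} (hi : 1 ≤ i) (him : i ≤ m) :
    -tau c < (spiralPt c i).re := by
  have hC : ∀ i : ℕ, 0 < 2 * (normSq c + 1 - 2 * c.re) / (normSq c - 1) / normSq (c ^ (i + 1)) :=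
    fun i => div_pos (spiral_step_pos h.one_lt h.im_pos)
      (normSq_pos.2 (pow_ne_zero _ (ne_zero_of_one_lt h.one_lt)))
  have := pos_of_increments h.one_lt h.im_pos h.turn_lt
    (a := fun i => (spiralPt c i).re + tau c)
    (C := fun i => 2 * (normSq c + 1 - 2 * c.re) / (normSq c - 1) / normSq (c ^ (i + 1)))
    (by rw [spiralPt_zero, ell0_re]; ring)
    hC
    (fun i => by
      have := spiralPt_succ_re_sub h.one_lt i
      linarith)
    (fun hpi => by
      have h1 := spiralPt_succ_re_sub h.one_lt m
      have h2 := h.pow_im_nonpos hpi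
      have h3 : (spiralPt c (m + 1)).re ≤ (spiralPt c m).re := by
        nlinarith [mul_nonneg (hC m).le (neg_nonneg.2 h2)]
      have h4 : -(spiralPt c m).re ≤ ((-1) * (⟨t, -1⟩ : ℂ)).re :=
        le_re_of_mem_segment h.mem (by simp) (by simpa using h3)
      have h5 := h.neg_tau_lt
      simp at h4
      linarith)
    hi him
  linarith

theorem pow_mul_pt_eq (h : Crossing c m t) {k j : ℕ} (hkj : k = j ∨ k = j + 1) :
    (c ^ k * spiralPt c j).re = -tau c := by
  rcases hkj with rfl | rfl
  · have := pow_mul_spiralPt' h.one_lt 0 k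
    rw [zero_add, pow_zero, one_mul] at this
    rw [this, ell0_re]
  · rw [add_comm, pow_mul_spiralPt' h.one_lt 1 j, pow_one, c_mul_ell0_re h.one_lt]

/-- Strict convexity: the vertex `ℓ_j` lies strictly inside all lines of the spiral except the two
through it. -/
theorem lt_pow_mul_pt (h : Crossing c m t) {k j : ℕ} (hk : k ≤ m + 1) (hj : j ≤ m)
    (h1 : k ≠ j) (h2 : k ≠ j + 1) : -tau c < (c ^ k * spiralPt c j).re := by
  rcases lt_or_gt_of_ne h1 with h3 | h3
  · obtain ⟨i, rfl⟩ := Nat.exists_eq_add_of_lt h3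
    rw [add_assoc, pow_mul_spiralPt h.one_lt]
    exact h.inner_pos (by omega) (by omega)
  · obtain ⟨i, rfl⟩ := Nat.exists_eq_add_of_lt h3
    obtain ⟨i, rfl⟩ : ∃ i', i = i' + 1 := Nat.exists_eq_succ_of_ne_zero (by omega)
    rw [show j + (i + 1) + 1 = (i + 1 + 1) + j by ring, pow_mul_spiralPt' h.one_lt]
    exact h.outer_pos (by omega) (by omega)

theorem pt_mem (h : Crossing c m t) {j : ℕ} (hj : j ≤ m) : spiralPt c j ∈ halfImage c m := by
  refine ⟨(h.above j hj).le, fun k hk => ?_⟩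
  by_cases h1 : k = j ∨ k = j + 1
  · exact (h.pow_mul_pt_eq h1).ge
  · push Not at h1
    exact (h.lt_pow_mul_pt hk hj h1.1 h1.2).le

/-- The image `c m_0` of the midpoint of `L_0` is a vertex. -/
theorem mid_mem (h : Crossing c m t) : (⟨-tau c, -1⟩ : ℂ) ∈ halfImage c m := by
  refine ⟨le_rfl, fun k hk => ?_⟩
  rcases Nat.lt_or_ge k (m + 1) with hk' | hk'
  · have key : ∀ i ≤ m + 1, -tau c ≤ (c ^ i * ell0 c).re := by
      intro i hi
      have := (h.pt_mem (Nat.zero_le m)).2 i hi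
      rwa [spiralPt_zero] at this
    have h1 := key k hk
    have h2 := key (k + 1) (by omega)
    rw [mid_eq h.one_lt, mul_smul_comm, real_smul, re_ofReal_mul, mul_add, add_re,
      ← mul_assoc, ← pow_succ]
    linarith
  · obtain rfl : k = m + 1 := le_antisymm hk hk'
    exact h.last_line_mid.le

/-- The image `c ζ` of the crossing point is a vertex. -/
theorem zeta_mem (h : Crossing c m t) : (⟨t, -1⟩ : ℂ) ∈ halfImage c m := by
  refine ⟨le_rfl, fun k hk => ?_⟩
  rcases Nat.eq_zero_or_pos k with rfl | hk0
  · simpa using h.neg_tau_lt.le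
  rcases Nat.lt_or_ge k (m + 1) with hk' | hk'
  · refine le_re_of_mem_segment h.mem ((h.pt_mem le_rfl).2 k hk) ?_
    obtain ⟨i, hi⟩ : ∃ i, m + 1 = k + i := ⟨m + 1 - k, by omega⟩
    rw [hi, pow_mul_spiralPt h.one_lt]
    exact (h.inner_pos (by omega) (by omega)).le
  · obtain rfl : k = m + 1 := le_antisymm hk hk'
    exact h.last_line.ge

/-- The part of the folding line between `c m_0` and `c ζ` belongs to the polygon. -/
theorem foldingLine_mem (h : Crossing c m t) {s : ℝ} (h1 : -tau c ≤ s) (h2 : s ≤ t) :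
    (⟨s, -1⟩ : ℂ) ∈ halfImage c m := by
  refine (convex_halfImage c m).segment_subset h.mid_mem h.zeta_mem ?_
  have hlt := h.neg_tau_lt
  have hpos : 0 < t + tau c := by linarith
  refine ⟨(t - s) / (t + tau c), (s + tau c) / (t + tau c), div_nonneg (by linarith) hpos.le,
    div_nonneg (by linarith) hpos.le, by field_simp; ring, ?_⟩
  apply Complex.ext
  · simp only [add_re, real_smul, re_ofReal_mul]; field_simp; ring
  · simp only [add_im, real_smul, im_ofReal_mul]; field_simp; ring

/-- The real part of `c γ₀`. -/
noncomputable def crossRe (c : ℂ) : ℝ := (normSq c - c.re) / c.im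

theorem mul_gamma0 (h : Crossing c m t) : c * gamma0 c = ⟨crossRe c, -1⟩ := by
  have := h.im_pos.ne'
  apply Complex.ext
  · simp [gamma0, crossRe, normSq_apply]; field_simp; ring
  · simp [gamma0]; field_simp; ring

theorem crossRe_le (h : Crossing c m t) : crossRe c ≤ t := by
  rw [crossRe, div_le_iff₀ h.im_pos, mul_comm]; exact h.low

theorem neg_tau_le_crossRe (h : Crossing c m t) : -tau c ≤ crossRe c := by
  have h1 := tau_pos h.one_lt h.im_pos
  have h2 : 0 ≤ crossRe c := by
    have hR := one_lt_normSq h.one_lt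
    refine div_nonneg ?_ h.im_pos.le
    rw [normSq_apply] at *
    nlinarith [sq_nonneg (c.re - 1)]
  linarith

theorem cross_mem (h : Crossing c m t) : (⟨crossRe c, -1⟩ : ℂ) ∈ halfImage c m :=
  h.foldingLine_mem h.neg_tau_le_crossRe h.crossRe_le

theorem gamma0_mem (h : Crossing c m t) (hm : 1 ≤ m) : gamma0 c ∈ halfImage c m := by
  have h1 := h.neg_one_le_re hm
  have hR := one_lt_normSq h.one_lt
  have hb := h.im_pos
  have e := normSq_apply c
  refine h.foldingLine_mem ?_ ?_
  · rw [tau, ← neg_div, div_le_div_iff₀ (by linarith) hb]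
    nlinarith [mul_nonneg (by linarith : 0 ≤ c.re + 1) (normSq_sub_one_pos hb).le]
  · refine le_trans ?_ h.crossRe_le
    rw [crossRe]
    exact div_le_div_of_nonneg_right (by linarith [normSq_sub_one_pos hb]) hb.le

end Crossing

/-! ### Forward invariance and escape -/

theorem f_of_ge {c w : ℂ} (h : -1 ≤ (c * w).im) : f c w = c * w := if_pos h

theorem f_of_le {c : ℂ} (hc : 1 < ‖c‖) {w : ℂ} (h : (c * w).im ≤ -1) :
    f c w = c * reflPFL c w := by rw [f_eq_mul_up hc, up_of_le hc h]

theorem f_im {c : ℂ} (hc : 1 < ‖c‖) (w : ℂ) : -1 ≤ (f c w).im := by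
  rw [f_eq_mul_up hc]; exact up_mem hc w

theorem f_re {c : ℂ} (hc : 1 < ‖c‖) (w : ℂ) : (f c w).re = (c * w).re := by
  rcases le_total (-1) (c * w).im with h | h
  · rw [f_of_ge h]
  · rw [f_of_le hc h, mul_reflPFL_re hc]

/-- The image of `w ∈ PH⁻` under `c * f`, in coordinates. -/
theorem mul_f_re_of_le {c : ℂ} (hc : 1 < ‖c‖) {w : ℂ} (h : (c * w).im ≤ -1) :
    (c * f c w).re = normSq c * w.re + 2 * c.im := by
  rw [f_of_le hc h, ← mul_assoc, ← sq, sq_mul_reflPFL_re hc]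

theorem mul_f_im_of_le {c : ℂ} (hc : 1 < ‖c‖) {w : ℂ} (h : (c * w).im ≤ -1) :
    (c * f c w).im = - normSq c * w.im - 2 * c.re := by
  rw [f_of_le hc h, ← mul_assoc, ← sq, sq_mul_reflPFL_im hc]

namespace Crossing

variable {c : ℂ} {m : ℕ} {t : ℝ}

theorem arg_mul_le (h : Crossing c m t) {i : ℕ} (hi : i ≤ m + 1) :
    (i : ℝ) * arg c < 3 * Real.pi / 2 := by
  refine lt_of_le_of_lt ?_ h.turn_lt
  have := arg_pos_of_im h.im_pos
  gcongr

/-- Since the total turning is less than three right angles, a power of `c` in the right half plane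
is in the first quadrant. -/
theorem im_nonneg_of_re_nonneg (h : Crossing c m t) {i : ℕ} (hi : i ≤ m + 1)
    (hre : 0 ≤ (c ^ i).re) : 0 ≤ (c ^ i).im := by
  have hr : 0 < ‖c‖ := by linarith [h.one_lt]
  have hth := arg_pos_of_im h.im_pos
  have h1 := h.arg_mul_le hi
  rw [pow_re_eq] at hre
  rw [pow_im_eq]
  refine mul_nonneg (by positivity) (Real.sin_nonneg_of_nonneg_of_le_pi (by positivity) ?_)
  by_contra! h2
  have := Real.cos_neg_of_pi_div_two_lt_of_lt (x := (i : ℝ) * arg c)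
    (by linarith [Real.pi_pos]) (by linarith)
  nlinarith [pow_pos hr i]

/-- Once a power of `c` has entered the left half plane, the next ones stay there, up to
the crossing. -/
theorem re_neg_of_re_neg (h : Crossing c m t) {i : ℕ} (hi : i ≤ m)
    (hre : (c ^ i).re < 0) : (c ^ (i + 1)).re < 0 := by
  have hr : 0 < ‖c‖ := by linarith [h.one_lt]
  have hth := arg_pos_of_im h.im_pos
  have h1 := h.arg_mul_le (i := i + 1) (by omega)
  rw [pow_re_eq] at hre ⊢
  refine mul_neg_of_pos_of_neg (by positivity) (Real.cos_neg_of_pi_div_two_lt_of_lt ?_ ?_)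
  · by_contra! h2
    have h3 : (i : ℝ) * arg c ≤ Real.pi / 2 := by
      push_cast at h2; linarith
    have := Real.cos_nonneg_of_neg_pi_div_two_le_of_le (x := (i : ℝ) * arg c)
      (by have : 0 ≤ (i : ℝ) * arg c := by positivity
          linarith [Real.pi_pos]) h3
    nlinarith [pow_pos hr i]
  · linarith

/-- A linear program. On the region `Im w ≥ -1`, `Re (c w) ≥ -tau c`, `Im (c w) ≤ κ`, each of the
functionals `Re (c ^ j w)` with `2 ≤ j ≤ m + 1` takes its minimum at one of the two
vertices `X` and `Y` on the line `Im (c w) = κ`. -/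
theorem le_of_cut (h : Crossing c m t) {κ : ℝ} {w X Y : ℂ} (h1 : -1 ≤ w.im)
    (h2 : -tau c ≤ (c * w).re) (h3 : (c * w).im ≤ κ)
    (hX : X ∈ halfImage c m) (hX1 : (c * X).re = -tau c) (hX2 : (c * X).im = κ)
    (hY : Y ∈ halfImage c m) (hY1 : Y.im = -1) (hY2 : (c * Y).im = κ)
    {j : ℕ} (hj : 2 ≤ j) (hjm : j ≤ m + 1) : -tau c ≤ (c ^ j * w).re := by
  obtain ⟨i, rfl⟩ : ∃ i, j = i + 1 := ⟨j - 1, by omega⟩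
  rcases le_or_gt 0 (c ^ i).re with hre | hre
  · have him := h.im_nonneg_of_re_nonneg (i := i) (by omega) hre
    have hX3 := hX.2 (i + 1) hjm
    rw [pow_succ, mul_assoc, mul_re, hX1, hX2] at hX3
    rw [pow_succ, mul_assoc, mul_re]
    nlinarith [mul_le_mul_of_nonneg_left h2 hre, mul_le_mul_of_nonneg_left h3 him]
  · have hre' := h.re_neg_of_re_neg (by omega) hre
    have hb := h.im_pos
    have hY3 := hY.2 (i + 1) hjm
    -- `c ^ (i + 1) = -i A + i B c` with `A, B ≥ 0`
    have key : ∀ v : ℂ, c.im * (c ^ (i + 1) * v).re =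
        (-(normSq c * (c ^ i).re)) * v.im + (c ^ (i + 1)).re * (c * v).im := by
      intro v
      rw [pow_succ, normSq_apply]
      simp only [mul_re, mul_im]
      ring
    have kw := key w
    have kY := key Y
    rw [hY1, hY2] at kY
    have hA : 0 ≤ -(normSq c * (c ^ i).re) := by
      nlinarith [one_lt_normSq h.one_lt]
    have : c.im * (c ^ (i + 1) * Y).re ≤ c.im * (c ^ (i + 1) * w).re := by
      rw [kw, kY]
      nlinarith [mul_le_mul_of_nonneg_left h1 hA,
        mul_le_mul_of_nonneg_left h3 (neg_nonneg.2 hre'.le)]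
    exact hY3.trans (le_of_mul_le_mul_left this hb)

/-- The points of the segment `c L_1`, written by their images under multiplication by `c`. -/
theorem exists_on_L1 (h : Crossing c m t) (hm : 1 ≤ m) {κ : ℝ}
    (h1 : 2 * (c.re - normSq c) / (normSq c - 1) ≤ κ) (h2 : κ ≤ 2 * (1 - c.re) / (normSq c - 1)) :
    ∃ X ∈ halfImage c m, (c * X).re = -tau c ∧ (c * X).im = κ := by
  have hR := one_lt_normSq h.one_lt
  have e0 : (c * ell0 c).im = 2 * (c.re - normSq c) / (normSq c - 1) := by
    have hne : normSq c - 1 ≠ 0 := by linarith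
    have e := normSq_apply c
    rw [mul_im, ell0_re, ell0_im, tau]
    field_simp
    linear_combination e
  have hlt : 2 * (c.re - normSq c) / (normSq c - 1) < 2 * (1 - c.re) / (normSq c - 1) := by
    rw [← e0, ← ell0_im]
    linarith [c_mul_ell0_im_lt h.one_lt h.im_pos, neg_one_lt_ell0_im h.one_lt h.im_pos]
  set A := 2 * (c.re - normSq c) / (normSq c - 1) with hA
  set B := 2 * (1 - c.re) / (normSq c - 1) with hB
  have hBA : 0 < B - A := by linarith
  set p := (κ - A) / (B - A) with hp
  have hp0 : 0 ≤ p := div_nonneg (by linarith) hBA.le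
  have hp1 : p ≤ 1 := by rw [hp, div_le_one hBA]; linarith
  have hmul : p * (B - A) = κ - A := by rw [hp]; exact div_mul_cancel₀ _ hBA.ne'
  refine ⟨(1 - p) • spiralPt c 0 + p • spiralPt c 1,
    convex_halfImage c m (h.pt_mem (Nat.zero_le m)) (h.pt_mem hm) (by linarith) hp0
      (by ring), ?_, ?_⟩
  · rw [mul_add, mul_smul_comm, mul_smul_comm, mul_ell_one h.one_lt, spiralPt_zero, add_re,
      real_smul, real_smul, re_ofReal_mul, re_ofReal_mul, c_mul_ell0_re h.one_lt, ell0_re]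
    ring
  · rw [mul_add, mul_smul_comm, mul_smul_comm, mul_ell_one h.one_lt, spiralPt_zero, add_im,
      real_smul, real_smul, im_ofReal_mul, im_ofReal_mul, e0, ell0_im, ← hB]
    linarith

/-- `f` maps the polygon `f (P)` into itself. -/
theorem f_mem (h : Crossing c m t) {w : ℂ} (hw : w ∈ halfImage c m) : f c w ∈ halfImage c m := by
  have hR := one_lt_normSq h.one_lt
  have hb := h.im_pos
  refine ⟨f_im h.one_lt w, fun k hk => ?_⟩
  rcases le_total (-1) (c * w).im with hcw | hcw
  · rw [f_of_ge hcw, ← mul_assoc, ← pow_succ]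
    rcases Nat.lt_or_ge k (m + 1) with hk' | hk'
    · exact hw.2 _ (by omega)
    · obtain rfl : k = m + 1 := le_antisymm hk hk'
      have hneg := h.pow_re_neg
      have hlast := hw.2 (m + 1) le_rfl
      rcases le_or_gt (c ^ (m + 1 + 1)).re 0 with hre | hre
      · -- the functional is a positive combination of `Im w` and `Re (c ^ (m + 1) w)`,
        -- and its minimum is at the vertex `c ζ`
        have key : ∀ v : ℂ, -(c ^ (m + 1)).re * (c ^ (m + 1 + 1) * v).re =
            -(c ^ (m + 1 + 1)).re * (c ^ (m + 1) * v).re + normSq (c ^ (m + 1)) * c.im * v.im := by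
          intro v
          rw [pow_succ c (m + 1), normSq_apply]
          simp only [mul_re, mul_im]
          ring
        have hZ : -tau c ≤ (c ^ (m + 1 + 1) * (⟨t, -1⟩ : ℂ)).re := by
          refine le_re_of_mem_segment h.mem ?_ ?_
          · rw [show m + 1 + 1 = 2 + m by ring, pow_mul_spiralPt' h.one_lt]
            have h1 := pow_mul_ell0_re_sub h.one_lt c
            rw [c_mul_ell0_re h.one_lt] at h1
            have h2 := mul_pos (spiral_step_pos h.one_lt hb) hb
            rw [sq]; linarith
          · rw [show m + 1 + 1 = 1 + (m + 1) by ring, pow_mul_spiralPt' h.one_lt, pow_one,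
              c_mul_ell0_re h.one_lt]
        have k1 := key w
        have k2 := key ⟨t, -1⟩
        rw [h.last_line] at k2
        have hN : 0 ≤ normSq (c ^ (m + 1)) * c.im := mul_nonneg (normSq_nonneg _) hb.le
        have : -(c ^ (m + 1)).re * (c ^ (m + 1 + 1) * (⟨t, -1⟩ : ℂ)).re ≤
            -(c ^ (m + 1)).re * (c ^ (m + 1 + 1) * w).re := by
          rw [k1, k2]
          have := hw.1
          gcongr
          linarith
        exact hZ.trans (le_of_mul_le_mul_left this (by linarith))
      · -- the functional is a positive combination of `Im w` and `Im (c w)`,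
        -- and its minimum is at the vertex `γ₀`
        have key : ∀ v : ℂ, c.im * (c ^ (m + 1 + 1) * v).re =
            (-(normSq c * (c ^ (m + 1)).re)) * v.im + (c ^ (m + 1 + 1)).re * (c * v).im := by
          intro v
          rw [pow_succ c (m + 1), normSq_apply]
          simp only [mul_re, mul_im]
          ring
        have hg := h.cross_mem.2 (m + 1) le_rfl
        rw [← h.mul_gamma0, ← mul_assoc, ← pow_succ] at hg
        have k1 := key w
        have k2 := key (gamma0 c)
        have e1 : (c * gamma0 c).im = -1 := by rw [h.mul_gamma0]
        have e2 : (gamma0 c).im = -1 := rfl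
        rw [e1, e2] at k2
        have hA : 0 ≤ -(normSq c * (c ^ (m + 1)).re) := by nlinarith
        have : c.im * (c ^ (m + 1 + 1) * gamma0 c).re ≤ c.im * (c ^ (m + 1 + 1) * w).re := by
          rw [k1, k2]
          have := hw.1
          gcongr
        exact hg.trans (le_of_mul_le_mul_left this hb)
  · have hw0 := hw.2 0 (by omega)
    have hw1 := hw.2 1 (by omega)
    rw [pow_zero, one_mul] at hw0
    rw [pow_one] at hw1
    have ht := tau_mul h.one_lt
    have hfre : -tau c ≤ (f c w).re := by rwa [f_re h.one_lt]
    have hcf : -tau c ≤ (c * f c w).re := by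
      rw [mul_f_re_of_le h.one_lt hcw]; nlinarith
    rcases Nat.lt_or_ge k 2 with hk2 | hk2
    · interval_cases k
      · simpa using hfre
      · simpa using hcf
    · have hm : 1 ≤ m := by omega
      have hR2 := h.normSq_le_two hm
      have hD := normSq_sub_one_pos hb
      have hb2 : c.im * crossRe c = normSq c - c.re := by
        rw [crossRe, mul_div_cancel₀ _ hb.ne']
      -- this is where `|c|² ≤ 2` enters: the image of `m_0` is on `L_{-1}`
      obtain ⟨X, hX, hX1, hX2⟩ := h.exists_on_L1 hm (κ := normSq c - 2 * c.re)
        (by rw [div_le_iff₀ (by linarith)]; nlinarith)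
        (by rw [le_div_iff₀ (by linarith)]; nlinarith)
      refine h.le_of_cut (f_im h.one_lt w) hcf ?_ hX hX1 hX2 h.cross_mem rfl ?_ hk2 hk
      · rw [mul_f_im_of_le h.one_lt hcw]
        nlinarith [hw.1]
      · rw [mul_im]; simp only; linarith

/-- A point above the folding line and outside the polygon, whose next image is folded, is
outside one of the first two lines. -/
theorem lt_or_lt_of_not_mem (h : Crossing c m t) {w : ℂ} (h1 : -1 ≤ w.im)
    (h2 : (c * w).im ≤ -1) (hw : w ∉ halfImage c m) : w.re < -tau c ∨ (c * w).re < -tau c := by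
  by_contra! hcon
  refine hw ⟨h1, fun k hk => ?_⟩
  rcases Nat.lt_or_ge k 2 with hk2 | hk2
  · interval_cases k
    · simpa using hcon.1
    · simpa using hcon.2
  · have hm : 1 ≤ m := by omega
    have hR := one_lt_normSq h.one_lt
    have hD := normSq_sub_one_pos h.im_pos
    obtain ⟨X, hX, hX1, hX2⟩ := h.exists_on_L1 hm (κ := -1)
      (by rw [div_le_iff₀ (by linarith)]; linarith)
      (by rw [le_div_iff₀ (by linarith)]; linarith)
    exact h.le_of_cut h1 hcon.2 h2 hX hX1 hX2 (h.gamma0_mem hm) rfl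
      (by rw [h.mul_gamma0]) hk2 hk

/-- A point outside the polygon stays outside as long as no fold occurs. -/
theorem mul_not_mem (h : Crossing c m t) {w : ℂ} (h1 : -1 ≤ w.im)
    (hw : w ∉ halfImage c m) (h2 : -1 ≤ (c * w).im) : c * w ∉ halfImage c m := by
  intro hcw
  refine hw ⟨h1, fun k hk => ?_⟩
  rcases Nat.eq_zero_or_pos k with rfl | hk0
  · have := hcw.2 1 (by omega)
    have hR := one_lt_normSq h.one_lt
    have ht := tau_mul h.one_lt
    have e : (c ^ 1 * (c * w)).re = normSq c * w.re - 2 * c.im * (c * w).im := by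
      rw [pow_one, normSq_apply]; simp only [mul_re, mul_im]; ring
    rw [e] at this
    rw [pow_zero, one_mul]
    by_contra! hlt
    nlinarith [mul_le_mul_of_nonneg_left h2 h.im_pos.le]
  · obtain ⟨i, rfl⟩ : ∃ i, k = i + 1 := ⟨k - 1, by omega⟩
    have := hcw.2 i (by omega)
    rwa [← mul_assoc, ← pow_succ] at this

end Crossing

/-- `w` is beyond one of the first two lines of the spiral, by a margin measured by `ε`. -/
def Beyond (c : ℂ) (ε : ℝ) (w : ℂ) : Prop :=
  w.re ≤ -tau c - ε ∨ (c * w).re ≤ -tau c - ε * ‖c‖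

/-- The map multiplies the margin by `|c|`. -/
theorem Beyond.image {c : ℂ} (hc : 1 < ‖c‖) (him : 0 < c.im) {ε : ℝ} {w : ℂ} (h : Beyond c ε w) :
    Beyond c (ε * ‖c‖) (f c w) := by
  have hR := one_lt_normSq hc
  have ht := tau_mul hc
  have hn : ‖c‖ * ‖c‖ = normSq c := by rw [normSq_eq_norm_sq]; ring
  rcases h with h | h
  · right
    rw [mul_assoc, hn]
    rcases le_total (-1) (c * w).im with hcw | hcw
    · have e : (c * (c * w)).re = normSq c * w.re - 2 * c.im * (c * w).im := by
        rw [normSq_apply]; simp only [mul_re, mul_im]; ring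
      rw [f_of_ge hcw, e]
      nlinarith [mul_le_mul_of_nonneg_left hcw him.le]
    · rw [mul_f_re_of_le hc hcw]
      nlinarith
  · left
    rwa [f_re hc]

theorem Beyond.iterate {c : ℂ} (hc : 1 < ‖c‖) (him : 0 < c.im) {ε : ℝ} {w : ℂ}
    (h : Beyond c ε w) (j : ℕ) : Beyond c (ε * ‖c‖ ^ j) ((f c)^[j] w) := by
  induction j with
  | zero => simpa using h
  | succ j ih =>
    rw [Function.iterate_succ_apply', pow_succ, ← mul_assoc]
    exact ih.image hc him

theorem Beyond.le_norm {c : ℂ} (hc : 1 < ‖c‖) (him : 0 < c.im) {ε : ℝ} {w : ℂ}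
    (h : Beyond c ε w) : ε ≤ ‖w‖ := by
  have ht := tau_pos hc him
  rcases h with h | h
  · linarith [neg_le_of_abs_le (abs_re_le_norm w)]
  · have h1 := neg_le_of_abs_le (abs_re_le_norm (c * w))
    rw [norm_mul] at h1
    have : ε * ‖c‖ ≤ ‖w‖ * ‖c‖ := by linarith
    exact le_of_mul_le_mul_right this (by linarith)

theorem Beyond.not_mem_K {c : ℂ} (hc : 1 < ‖c‖) (him : 0 < c.im) {ε : ℝ} {w z : ℂ} (hε : 0 < ε)
    (h : Beyond c ε w) {k : ℕ} (hk : (f c)^[k] z = w) : z ∉ K c := by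
  intro hz
  have hz' : Bornology.IsBounded (Set.range fun n : ℕ => (f c)^[n] z) := hz
  obtain ⟨M, hM⟩ := hz'.exists_norm_le
  obtain ⟨j, hj⟩ := pow_unbounded_of_one_lt (M / ε) hc
  rw [div_lt_iff₀ hε] at hj
  have h1 := (h.iterate hc him j).le_norm hc him
  have h2 := hM _ ⟨j + k, rfl⟩
  simp only [Function.iterate_add_apply, hk] at h2
  linarith

theorem exists_beyond {c : ℂ} (hc : 1 < ‖c‖) {w : ℂ}
    (h : w.re < -tau c ∨ (c * w).re < -tau c) : ∃ ε > 0, Beyond c ε w := by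
  have h0 : 0 < ‖c‖ := by linarith
  rcases h with h | h
  · exact ⟨-tau c - w.re, by linarith, Or.inl (by linarith)⟩
  · refine ⟨(-tau c - (c * w).re) / ‖c‖, div_pos (by linarith) h0, Or.inr ?_⟩
    rw [div_mul_cancel₀ _ h0.ne']; linarith

namespace Crossing

variable {c : ℂ} {m : ℕ} {t : ℝ}

/-- Points outside the polygon come, after finitely many steps, beyond one of the first two
lines. -/
theorem exists_iterate_beyond (h : Crossing c m t) (k : ℕ) (w : ℂ) (hw : -1 ≤ w.im)
    (hk : k ≤ m + 1) (hlt : (c ^ k * w).re < -tau c) :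
    ∃ j, ∃ ε > 0, Beyond c ε ((f c)^[j] w) := by
  induction k generalizing w with
  | zero =>
    obtain ⟨ε, hε, hb⟩ := exists_beyond h.one_lt (w := w) (Or.inl (by simpa using hlt))
    exact ⟨0, ε, hε, hb⟩
  | succ k ih =>
    rcases le_total (-1) (c * w).im with hcw | hcw
    · obtain ⟨j, ε, hε, hb⟩ := ih (c * w) hcw (by omega) (by rwa [← mul_assoc, ← pow_succ])
      refine ⟨j + 1, ε, hε, ?_⟩
      rwa [Function.iterate_succ_apply, f_of_ge hcw]
    · have hnm : w ∉ halfImage c m := fun hm => absurd (hm.2 _ hk) (not_le.2 hlt)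
      obtain ⟨ε, hε, hb⟩ := exists_beyond h.one_lt (h.lt_or_lt_of_not_mem hw hcw hnm)
      exact ⟨0, ε, hε, hb⟩

theorem f_mem_of_mem_K (h : Crossing c m t) {z : ℂ} (hz : z ∈ K c) : f c z ∈ halfImage c m := by
  by_contra hcon
  have hk : ∃ k ≤ m + 1, (c ^ k * f c z).re < -tau c := by
    by_contra! h'
    exact hcon ⟨f_im h.one_lt z, h'⟩
  obtain ⟨k, hk, hlt⟩ := hk
  obtain ⟨j, ε, hε, hb⟩ := h.exists_iterate_beyond k _ (f_im h.one_lt z) hk hlt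
  refine hb.not_mem_K h.one_lt h.im_pos hε (k := j + 1) ?_ hz
  rw [Function.iterate_succ_apply]

end Crossing

/-! ### The perimeter set is the filled Julia set -/

/-- Some power of `c` has its argument in `[π/2, π)`. -/
theorem exists_pow_quadrant {c : ℂ} (him : 0 < c.im) :
    ∃ N : ℕ, (c ^ N).re ≤ 0 ∧ 0 < (c ^ N).im ∧
      ∀ n : ℕ, Real.pi / 2 ≤ n * arg c → N ≤ n := by
  have hth := arg_pos_of_im him
  have hth' := arg_lt_pi_of_im him
  have hpi := Real.pi_pos
  have hr : 0 < ‖c‖ := norm_pos_iff.2 (by rintro rfl; simp at him)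
  set N := ⌈Real.pi / 2 / arg c⌉₊ with hN
  have h1 : Real.pi / 2 ≤ N * arg c := by
    rw [← div_le_iff₀ hth]; exact Nat.le_ceil _
  have h2 : N * arg c < Real.pi := by
    rcases le_or_gt (Real.pi / 2) (arg c) with h | h
    · have : N ≤ 1 := by
        rw [hN, Nat.ceil_le, div_le_iff₀ hth]; simpa using h
      have : (N : ℝ) ≤ 1 := by exact_mod_cast this
      nlinarith
    · have h3 := Nat.ceil_lt_add_one (div_nonneg (by linarith) hth.le : 0 ≤ Real.pi / 2 / arg c)
      rw [← hN] at h3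
      have h4 : N * arg c < (Real.pi / 2 / arg c + 1) * arg c := by gcongr
      rw [add_mul, div_mul_cancel₀ _ hth.ne'] at h4
      linarith
  refine ⟨N, ?_, ?_, fun n hn => ?_⟩
  · rw [pow_re_eq]
    refine mul_nonpos_of_nonneg_of_nonpos (by positivity) ?_
    exact Real.cos_nonpos_of_pi_div_two_le_of_le h1 (by linarith)
  · rw [pow_im_eq]
    exact mul_pos (by positivity) (Real.sin_pos_of_pos_of_lt_pi (by linarith) h2)
  · rw [hN, Nat.ceil_le, div_le_iff₀ hth]; exact hn

/-- An expanding rotation takes every point but `0` below the folding line. -/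
theorem exists_pow_mul_im_le {c : ℂ} (hc : 1 < ‖c‖) (him : 0 < c.im) {w : ℂ} (hw : w ≠ 0) :
    ∃ k : ℕ, (c ^ k * w).im ≤ -1 := by
  by_contra! hcon
  obtain ⟨N, hN1, hN2, -⟩ := exists_pow_quadrant him
  set C := c ^ N with hC
  have hN0 : N ≠ 0 := by rintro rfl; simp [hC] at hN1; linarith
  have hC1 : 1 < ‖C‖ := by rw [hC, norm_pow]; exact one_lt_pow₀ hc hN0
  have hCR := one_lt_normSq hC1
  have hy : ∀ j : ℕ, -1 < (C ^ j * w).im := fun j => by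
    rw [hC, ← pow_mul]; exact hcon _
  have hstep : ∀ j : ℕ, C ^ (j + 1) * w = C * (C ^ j * w) := fun j => by rw [pow_succ]; ring
  have hbd : ∀ j : ℕ, ‖C‖ ^ j * ‖w‖ ≤
      (1 - 2 * C.re) * (1 - C.re) / C.im + (1 - 2 * C.re) := by
    intro j
    have hle : ∀ i, (C ^ i * w).im ≤ 1 - 2 * C.re := by
      intro i
      have h0 := hy i
      have h1 := hy (i + 1)
      have h2 := hy (i + 2)
      have e : (C ^ (i + 2) * w).im = 2 * C.re * (C ^ (i + 1) * w).im -
          normSq C * (C ^ i * w).im := by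
        rw [hstep (i + 1), hstep i, normSq_apply]
        simp only [mul_re, mul_im]; ring
      by_contra! h3
      nlinarith [mul_nonneg (neg_nonneg.2 hN1) (by linarith : 0 ≤ (C ^ (i + 1) * w).im + 1)]
    have h0 := hy j
    have h1 := hy (j + 1)
    have h2 := hle j
    have h3 := hle (j + 1)
    have e : C.im * (C ^ j * w).re = (C ^ (j + 1) * w).im - C.re * (C ^ j * w).im := by
      rw [hstep j]; simp only [mul_im]; ring
    rw [← norm_pow, ← norm_mul]
    refine (norm_le_abs_re_add_abs_im _).trans (add_le_add ?_ ?_)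
    · rw [le_div_iff₀ hN2, ← abs_of_pos hN2, ← abs_mul, mul_comm, e, abs_le]
      constructor <;> nlinarith
    · rw [abs_le]; constructor <;> linarith
  have hwp : 0 < ‖w‖ := norm_pos_iff.2 hw
  obtain ⟨j, hj⟩ := pow_unbounded_of_one_lt
    (((1 - 2 * C.re) * (1 - C.re) / C.im + (1 - 2 * C.re)) / ‖w‖) hC1
  rw [div_lt_iff₀ hwp] at hj
  linarith [hbd j]

theorem mem_Sreg_iff {c : ℂ} (hc : 1 < ‖c‖) (him : 0 < c.im) (k : ℕ) (z : ℂ) :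
    z ∈ Sreg c k ↔ (∀ i ≤ k, -1 ≤ (c ^ (i + 1) * z).im) ∧ (c ^ (k + 2) * z).im ≤ -1 ∧
      ((c ^ (k + 1) * z).re ≤ -tau c ∨ (c ^ (k + 2) * z).re ≤ -tau c) := by
  induction k generalizing z with
  | zero =>
    rw [Sreg, mem_S1_iff hc him, ← mul_assoc, ← sq]
    simp
  | succ k ih =>
    have e : ∀ i : ℕ, c ^ (i + 1) * (c * z) = c ^ (i + 1 + 1) * z := fun i => by
      rw [pow_succ c (i + 1)]; ring
    have : z ∈ Sreg c (k + 1) ↔ c * z ∈ Sreg c k ∧ z ∈ PHplus c := Iff.rfl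
    rw [this, ih, mem_PHplus_iff]
    simp only [e]
    constructor
    · rintro ⟨⟨h1, h2, h3⟩, h4⟩
      refine ⟨fun i hi => ?_, h2, h3⟩
      rcases i with _ | i
      · simpa using h4
      · exact h1 i (by omega)
    · rintro ⟨h1, h2, h3⟩
      refine ⟨⟨fun i hi => h1 (i + 1) (by omega), h2, h3⟩, ?_⟩
      simpa using h1 0 (by omega)

/-- The points that the map sends into the convex polygon `halfImage c m`. It turns out to be both
the perimeter set and the filled Julia set. -/
def solid (c : ℂ) (m : ℕ) : Set ℂ := {z | f c z ∈ halfImage c m}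

theorem continuous_f {c : ℂ} (hc : 1 < ‖c‖) : Continuous (f c) := by
  rw [show f c = fun z => c * up c z from funext (f_eq_mul_up hc)]
  exact continuous_const.mul (continuous_up hc)

theorem isClosed_solid {c : ℂ} (hc : 1 < ‖c‖) (m : ℕ) : IsClosed (solid c m) :=
  (isClosed_halfImage c m).preimage (continuous_f hc)

theorem reflPFL_mem_solid {c : ℂ} (hc : 1 < ‖c‖) {m : ℕ} {z : ℂ} (hz : z ∈ solid c m) :
    reflPFL c z ∈ solid c m := by
  have hz' : f c z ∈ halfImage c m := hz
  change f c (reflPFL c z) ∈ halfImage c m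
  rwa [f_eq_mul_up hc, up_reflPFL hc, ← f_eq_mul_up hc]

/-- The union `S ∪ S'`. -/
def outer (c : ℂ) : Set ℂ := S c ∪ reflPFL c '' S c

theorem reflPFL_mem_outer {c : ℂ} (hc : 1 < ‖c‖) {z : ℂ} (hz : z ∈ outer c) :
    reflPFL c z ∈ outer c := by
  rcases hz with hz | ⟨x, hx, rfl⟩
  · exact Or.inr ⟨z, hz, rfl⟩
  · rw [reflPFL_reflPFL hc]; exact Or.inl hx

namespace Crossing

variable {c : ℂ} {m : ℕ} {t : ℝ}

theorem zero_mem (h : Crossing c m t) : (0 : ℂ) ∈ halfImage c m :=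
  ⟨by simp, fun k _ => by simpa using (tau_pos h.one_lt h.im_pos).le⟩

theorem isBounded_halfImage (h : Crossing c m t) : Bornology.IsBounded (halfImage c m) := by
  obtain ⟨N, hN1, hN2, hN3⟩ := exists_pow_quadrant h.im_pos
  have hNm : N ≤ m + 1 := hN3 _ h.lt_turn.le
  have ht := tau_pos h.one_lt h.im_pos
  have hneg := h.pow_re_neg
  set Y := (1 - (c ^ N).re) * tau c / (c ^ N).im with hY
  have hY0 : 0 ≤ Y := div_nonneg (mul_nonneg (by linarith) ht.le) hN2.le
  set X := (tau c + |(c ^ (m + 1)).im| * (Y + 1)) / (-(c ^ (m + 1)).re) with hX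
  have hX0 : 0 ≤ X := div_nonneg (by positivity) (by linarith)
  refine (Metric.isBounded_closedBall (x := (0 : ℂ)) (r := (X + tau c) + (Y + 1))).subset ?_
  intro w hw
  rw [mem_closedBall_zero_iff]
  have h0 := hw.2 0 (by omega)
  have h1 := hw.2 N hNm
  have h2 := hw.2 (m + 1) le_rfl
  have h3 := hw.1
  rw [pow_zero, one_mul] at h0
  rw [mul_re] at h1 h2
  have hy : w.im ≤ Y := by
    rw [hY, le_div_iff₀ hN2]
    nlinarith [mul_nonneg (neg_nonneg.2 hN1) (by linarith : 0 ≤ w.re + tau c)]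
  have hyabs : |w.im| ≤ Y + 1 := by rw [abs_le]; constructor <;> linarith
  have hx : w.re ≤ X := by
    rw [hX, le_div_iff₀ (by linarith)]
    have h4 : -((c ^ (m + 1)).im * w.im) ≤ |(c ^ (m + 1)).im| * (Y + 1) := by
      refine (neg_le_abs _).trans ?_
      rw [abs_mul]; gcongr
    linarith
  refine (norm_le_abs_re_add_abs_im _).trans (add_le_add ?_ hyabs)
  rw [abs_le]; constructor <;> linarith

theorem iterate_mem (h : Crossing c m t) {w : ℂ} (hw : w ∈ halfImage c m) (j : ℕ) :
    (f c)^[j] w ∈ halfImage c m := by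
  induction j with
  | zero => exact hw
  | succ j ih => rw [Function.iterate_succ_apply']; exact h.f_mem ih

theorem solid_eq_K (h : Crossing c m t) : solid c m = K c := by
  ext z
  refine ⟨fun hz => ?_, fun hz => h.f_mem_of_mem_K hz⟩
  have hz' : f c z ∈ halfImage c m := hz
  change Bornology.IsBounded (Set.range fun n : ℕ => (f c)^[n] z)
  refine (h.isBounded_halfImage.insert z).subset ?_
  rintro _ ⟨n, rfl⟩
  rcases n with _ | n
  · exact Or.inl rfl
  · exact Or.inr (by simp only [Function.iterate_succ_apply]; exact h.iterate_mem hz' n)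

theorem gamma0_mem_solid (h : Crossing c m t) : gamma0 c ∈ solid c m := by
  change f c (gamma0 c) ∈ halfImage c m
  rw [f_of_ge (by rw [h.mul_gamma0]), h.mul_gamma0]
  exact h.cross_mem

theorem mem_outer_of_not_mem_solid (h : Crossing c m t) {z : ℂ} (hz : z ∉ solid c m) :
    z ∈ outer c := by
  set y := up c z with hy
  have hcy : c * y ∉ halfImage c m := by rw [hy, ← f_eq_mul_up h.one_lt]; exact hz
  have hym : -1 ≤ (c * y).im := up_mem h.one_lt z
  have hyS : y ∈ S c := by
    have hy0 : c ^ 2 * y ≠ 0 := by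
      intro h0
      rcases mul_eq_zero.1 h0 with h1 | h1
      · exact pow_ne_zero 2 (ne_zero_of_one_lt h.one_lt) h1
      · rw [h1, mul_zero] at hcy
        exact hcy h.zero_mem
    classical
    have hex : ∃ k : ℕ, (c ^ (k + 2) * y).im ≤ -1 := by
      obtain ⟨k, hk⟩ := exists_pow_mul_im_le h.one_lt h.im_pos hy0
      exact ⟨k, by rwa [pow_add, mul_assoc]⟩
    set k := Nat.find hex with hk
    have hk1 : (c ^ (k + 2) * y).im ≤ -1 := Nat.find_spec hex
    have hk2 : ∀ i ≤ k, -1 ≤ (c ^ (i + 1) * y).im := by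
      intro i hi
      rcases i with _ | i
      · simpa using hym
      · have := Nat.find_min hex (m := i) (by omega)
        exact (not_le.1 this).le
    have hk3 : ∀ i ≤ k, c ^ (i + 1) * y ∉ halfImage c m := by
      intro i
      induction i with
      | zero => intro _; simpa using hcy
      | succ i ih =>
        intro hi
        have e : c ^ (i + 1 + 1) * y = c * (c ^ (i + 1) * y) := by rw [pow_succ c (i + 1)]; ring
        rw [e]
        refine h.mul_not_mem (hk2 i (by omega)) (ih (by omega)) ?_
        rw [← e]; exact hk2 _ hi
    have e : c ^ (k + 2) * y = c * (c ^ (k + 1) * y) := by rw [pow_succ c (k + 1)]; ring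
    refine Set.mem_iUnion.2 ⟨k, (mem_Sreg_iff h.one_lt h.im_pos k y).2 ⟨hk2, hk1, ?_⟩⟩
    have := h.lt_or_lt_of_not_mem (hk2 k le_rfl) (by rw [← e]; exact hk1) (hk3 k le_rfl)
    rw [← e] at this
    exact this.imp le_of_lt le_of_lt
  rcases le_total (-1) (c * z).im with hcz | hcz
  · rw [hy, up_of_mem hcz] at hyS
    exact Or.inl hyS
  · rw [hy, up_of_le h.one_lt hcz] at hyS
    exact Or.inr ⟨_, hyS, reflPFL_reflPFL h.one_lt z⟩

/-- A point of the open upper part of the solid polygon that belongs to `S` is on one of countably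
many lines. -/
theorem exists_line_of_mem_outer (h : Crossing c m t) {x : ℂ} (hx : -1 < (c * x).im)
    (hxm : c * x ∈ halfImage c m) (hxS : x ∈ outer c) : ∃ k : ℕ, (c ^ k * x).re = -tau c := by
  have hxS' : x ∈ S c := by
    rcases hxS with hxS | ⟨w, hw, rfl⟩
    · exact hxS
    · obtain ⟨k, hk⟩ := Set.mem_iUnion.1 hw
      have := ((mem_Sreg_iff h.one_lt h.im_pos k w).1 hk).1 0 (by omega)
      rw [zero_add, pow_one] at this
      rw [mul_reflPFL_im h.one_lt] at hx
      linarith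
  obtain ⟨k, hk⟩ := Set.mem_iUnion.1 hxS'
  obtain ⟨h1, -, h3⟩ := (mem_Sreg_iff h.one_lt h.im_pos k x).1 hk
  have hmem : ∀ i ≤ k, c ^ (i + 1) * x ∈ halfImage c m := by
    intro i
    induction i with
    | zero => intro _; simpa using hxm
    | succ i ih =>
      intro hi
      have e : c ^ (i + 1 + 1) * x = c * (c ^ (i + 1) * x) := by rw [pow_succ c (i + 1)]; ring
      have h4 := h1 _ hi
      have := h.f_mem (ih (by omega))
      rw [e] at h4 ⊢
      rwa [f_of_ge h4] at this
  have hk0 := (hmem k le_rfl).2 0 (by omega)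
  have hk1 := (hmem k le_rfl).2 1 (by omega)
  rw [pow_zero, one_mul] at hk0
  rw [pow_one, ← mul_assoc, ← pow_succ'] at hk1
  rcases h3 with h3 | h3
  · exact ⟨_, le_antisymm h3 hk0⟩
  · exact ⟨_, le_antisymm h3 hk1⟩

theorem P_eq_solid (h : Crossing c m t) : P c = solid c m := by
  have hτ := tau_pos h.one_lt h.im_pos
  ext z
  constructor
  · intro hz
    by_contra hzs
    refine hz ?_
    exact mem_interior.2 ⟨(solid c m)ᶜ, fun x hx => h.mem_outer_of_not_mem_solid hx,
      (isClosed_solid h.one_lt m).isOpen_compl, hzs⟩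
  · intro hz hzint
    obtain ⟨U, hU, hUo, hzU⟩ := mem_interior.1 hzint
    obtain ⟨V, y, hVo, hyV, hV, hy⟩ : ∃ (V : Set ℂ) (y : ℂ), IsOpen V ∧ y ∈ V ∧ V ⊆ outer c ∧
        c * y ∈ halfImage c m := by
      rcases le_total (-1) (c * z).im with hcz | hcz
      · refine ⟨U, z, hUo, hzU, hU, ?_⟩
        have : f c z ∈ halfImage c m := hz
        rwa [f_of_ge hcz] at this
      · refine ⟨reflPFL c ⁻¹' U, reflPFL c z, hUo.preimage (continuous_reflPFL c), ?_, ?_, ?_⟩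
        · rw [Set.mem_preimage, reflPFL_reflPFL h.one_lt]; exact hzU
        · intro x hx
          have := reflPFL_mem_outer h.one_lt (hU hx)
          rwa [reflPFL_reflPFL h.one_lt] at this
        · have : f c z ∈ halfImage c m := hz
          rwa [f_of_le h.one_lt hcz] at this
    -- points `s y` with `s < 1` close to `1` are in the interior and on countably many lines
    have hcount : (⋃ k : ℕ, {s : ℝ | s * (c ^ k * y).re = -tau c}).Countable := by
      refine Set.countable_iUnion fun k => Set.Subsingleton.countable ?_
      intro a ha b hb
      have ha' : a * (c ^ k * y).re = -tau c := ha
      have hb' : b * (c ^ k * y).re = -tau c := hb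
      have hne : (c ^ k * y).re ≠ 0 := by
        intro h0; rw [h0, mul_zero] at ha'; linarith
      exact mul_right_cancel₀ hne (ha'.trans hb'.symm)
    have hW : IsOpen ({s : ℝ | (s : ℂ) * y ∈ V}) :=
      hVo.preimage (continuous_ofReal.mul continuous_const)
    have h1 : (1 : ℝ) ∈ {s : ℝ | (s : ℂ) * y ∈ V} := by
      change ((1 : ℝ) : ℂ) * y ∈ V
      simpa using hyV
    obtain ⟨δ, hδ, hball⟩ := Metric.isOpen_iff.1 hW 1 h1
    have hIoo : (Set.Ioo (max 0 (1 - δ)) 1).Nonempty :=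
      Set.nonempty_Ioo.2 (max_lt one_pos (by linarith))
    obtain ⟨s, hs1, hs2⟩ := (hcount.dense_compl ℝ).inter_open_nonempty _ isOpen_Ioo hIoo
    have hs0 : 0 < s := (le_max_left _ _).trans_lt hs1.1
    have hsV : (s : ℂ) * y ∈ V := hball (by
      rw [Metric.mem_ball, Real.dist_eq, abs_lt]
      have := (le_max_right 0 (1 - δ)).trans_lt hs1.1
      constructor <;> linarith [hs1.2])
    have e : ∀ w : ℂ, w * ((s : ℂ) * y) = s * (w * y) := fun w => by ring
    have him : -1 < (c * ((s : ℂ) * y)).im := by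
      rw [e, im_ofReal_mul]
      nlinarith [hy.1, hs1.2]
    have hmem : c * ((s : ℂ) * y) ∈ halfImage c m := by
      rw [e, ← real_smul]
      exact ((convex_halfImage c m).starConvex h.zero_mem).smul_mem hy hs0.le hs1.2.le
    obtain ⟨k, hk⟩ := h.exists_line_of_mem_outer him hmem (hV hsV)
    rw [e, re_ofReal_mul] at hk
    exact hs2 (Set.mem_iUnion.2 ⟨k, hk⟩)

end Crossing

/-! ### The edges of the polygon -/

theorem reflPFL_combo {c : ℂ} (hc : 1 < ‖c‖) {p q : ℝ} (hpq : p + q = 1) (a b : ℂ) :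
    reflPFL c (p • a + q • b) = p • reflPFL c a + q • reflPFL c b := by
  have hq : q = 1 - p := by linarith
  apply eq_of_mul hc
  · rw [mul_reflPFL_re hc, mul_add, mul_add, mul_smul_comm, mul_smul_comm, mul_smul_comm,
      mul_smul_comm]
    simp only [add_re, real_smul, re_ofReal_mul, mul_reflPFL_re hc]
  · rw [mul_reflPFL_im hc, mul_add, mul_add, mul_smul_comm, mul_smul_comm, mul_smul_comm,
      mul_smul_comm]
    simp only [add_im, real_smul, im_ofReal_mul, mul_reflPFL_im hc]
    rw [hq]; ring

theorem reflPFL_mem_segment {c : ℂ} (hc : 1 < ‖c‖) {a b z : ℂ} (hz : z ∈ segment ℝ a b) :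
    reflPFL c z ∈ segment ℝ (reflPFL c a) (reflPFL c b) := by
  obtain ⟨p, q, hp, hq, hpq, rfl⟩ := hz
  exact ⟨p, q, hp, hq, hpq, (reflPFL_combo hc hpq a b).symm⟩

theorem mem_segment_reflPFL_iff {c : ℂ} (hc : 1 < ‖c‖) {a b z : ℂ} :
    z ∈ segment ℝ (reflPFL c a) (reflPFL c b) ↔ reflPFL c z ∈ segment ℝ a b := by
  constructor <;> intro hz
  · have := reflPFL_mem_segment hc hz
    rwa [reflPFL_reflPFL hc, reflPFL_reflPFL hc] at this
  · have := reflPFL_mem_segment hc hz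
    rwa [reflPFL_reflPFL hc] at this

theorem mul_mem_segment {c a b z : ℂ} (hz : z ∈ segment ℝ a b) :
    c * z ∈ segment ℝ (c * a) (c * b) := by
  obtain ⟨p, q, hp, hq, hpq, rfl⟩ := hz
  exact ⟨p, q, hp, hq, hpq, by rw [mul_add, mul_smul_comm, mul_smul_comm]⟩

theorem mem_segment_of_mul {c : ℂ} (hc : c ≠ 0) {a b z : ℂ}
    (hz : c * z ∈ segment ℝ (c * a) (c * b)) : z ∈ segment ℝ a b := by
  have := mul_mem_segment (c := c⁻¹) hz
  rwa [inv_mul_cancel_left₀ hc, inv_mul_cancel_left₀ hc, inv_mul_cancel_left₀ hc] at this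

/-- A point of a segment where a functional attains its minimum is an end point, if the value at
the other end point is not the minimum. -/
theorem eq_right_of_re_eq {a b z w : ℂ} {s : ℝ} (hz : z ∈ segment ℝ a b)
    (ha : s < (w * a).re) (hb : s ≤ (w * b).re) (h : (w * z).re = s) : z = b := by
  obtain ⟨p, q, hp, hq, hpq, rfl⟩ := hz
  have e : (w * (p • a + q • b)).re = p * (w * a).re + q * (w * b).re := by
    simp; ring
  rw [e] at h
  have h1 : p * ((w * a).re - s) + q * ((w * b).re - s) = 0 := by
    linear_combination h - s * hpq
  have h2 : p = 0 := by
    have h3 := mul_nonneg hp (sub_pos.2 ha).le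
    have h4 := mul_nonneg hq (sub_nonneg.2 hb)
    have h5 : p * ((w * a).re - s) = 0 := by linarith
    exact (mul_eq_zero.1 h5).resolve_right (sub_pos.2 ha).ne'
  have h3 : q = 1 := by linarith
  rw [h2, h3]; simp

theorem eq_right_of_im_eq {a b z : ℂ} {s : ℝ} (hz : z ∈ segment ℝ a b)
    (ha : s < a.im) (hb : s ≤ b.im) (h : z.im = s) : z = b :=
  eq_right_of_re_eq (w := -I) hz (by simpa using ha) (by simpa using hb) (by simpa using h)

/-- The second end point of the `j`-th upper edge. -/
noncomputable def upperEnd (c : ℂ) (m : ℕ) (ζ : ℂ) (j : ℕ) : ℂ :=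
  if j ≤ m then spiralPt c (j + 1) else ζ

/-- The edges of the outer-most boundary that meet `PH⁺`: the segments `L_j` for `j ≤ m`, and the
segment `[ℓ_{m+1}, ζ]`. -/
noncomputable def upperEdge (c : ℂ) (m : ℕ) (ζ : ℂ) (j : ℕ) : Set ℂ :=
  segment ℝ (spiralPt c j) (upperEnd c m ζ j)

/-- The start of the `j`-th upper edge, scaled by `c`; the edge `L_0` is cut at its midpoint. -/
noncomputable def startPt (c : ℂ) : ℕ → ℂ
  | 0 => ⟨-tau c, -1⟩
  | j + 1 => spiralPt c j

namespace Crossing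

variable {c : ℂ} {m : ℕ} {t : ℝ} {ζ : ℂ}

theorem mul_upperEnd_mem (h : Crossing c m t) (hζ : c * ζ = ⟨t, -1⟩) {j : ℕ} :
    c * upperEnd c m ζ j ∈ halfImage c m := by
  rw [upperEnd]
  split_ifs with hj
  · rw [mul_spiralPt_succ h.one_lt]; exact h.pt_mem hj
  · rw [hζ]; exact h.zeta_mem

theorem startPt_mem (h : Crossing c m t) {j : ℕ} (hj : j ≤ m + 1) :
    startPt c j ∈ halfImage c m := by
  rcases j with _ | j
  · exact h.mid_mem
  · exact h.pt_mem (by omega)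

/-- The part of an upper edge in `PH⁺`, scaled by `c`, starts at `startPt`. -/
theorem mul_mem_segment_startPt (h : Crossing c m t) {j : ℕ}
    {z : ℂ} (hz : z ∈ upperEdge c m ζ j) (him : -1 ≤ (c * z).im) :
    c * z ∈ segment ℝ (startPt c j) (c * upperEnd c m ζ j) := by
  have hz' := mul_mem_segment (c := c) hz
  rcases j with _ | j
  · have e : c * upperEnd c m ζ 0 = ell0 c := by
      rw [upperEnd, if_pos (Nat.zero_le _), mul_ell_one h.one_lt]
    rw [e] at hz' ⊢
    rw [spiralPt_zero] at hz'
    have hre : (c * z).re = -tau c := by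
      have := re_eq_of_mem_segment (w := 1) (s := -tau c) hz'
        (by rw [one_mul, c_mul_ell0_re h.one_lt]) (by rw [one_mul, ell0_re])
      rwa [one_mul] at this
    have hle : (c * z).im ≤ (ell0 c).im := by
      have h1 := c_mul_ell0_im_lt h.one_lt h.im_pos
      have h2 := neg_one_lt_ell0_im h.one_lt h.im_pos
      have := le_re_of_mem_segment (w := I) (s := -(ell0 c).im) hz' (by simp at h1 ⊢; linarith)
        (by simp)
      simp at this ⊢
      linarith
    have h2 := neg_one_lt_ell0_im h.one_lt h.im_pos
    have hpos : 0 < (ell0 c).im + 1 := by linarith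
    refine ⟨((ell0 c).im - (c * z).im) / ((ell0 c).im + 1), ((c * z).im + 1) / ((ell0 c).im + 1),
      div_nonneg (by linarith) hpos.le, div_nonneg (by linarith) hpos.le,
      by field_simp; ring, ?_⟩
    apply Complex.ext
    · simp only [startPt, add_re, real_smul, re_ofReal_mul]
      rw [hre, ell0_re]; field_simp; ring
    · simp only [startPt, add_im, real_smul, im_ofReal_mul]
      field_simp; ring
  · rwa [mul_spiralPt_succ h.one_lt] at hz'

theorem mul_mem_of_mem_upperEdge (h : Crossing c m t) (hζ : c * ζ = ⟨t, -1⟩) {j : ℕ}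
    (hj : j ≤ m + 1) {z : ℂ} (hz : z ∈ upperEdge c m ζ j) (him : -1 ≤ (c * z).im) :
    c * z ∈ halfImage c m :=
  (convex_halfImage c m).segment_subset (h.startPt_mem hj) (h.mul_upperEnd_mem hζ)
    (h.mul_mem_segment_startPt hz him)

/-- The upper edges other than `L_0` lie strictly on the `PH⁺` side of the pre-folding line, except
for the end point `ζ` of the last one. -/
theorem upperEdge_im (h : Crossing c m t) (hζ : c * ζ = ⟨t, -1⟩) {j : ℕ} (h1 : 1 ≤ j)
    (hj : j ≤ m + 1) {z : ℂ} (hz : z ∈ upperEdge c m ζ j) :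
    -1 < (c * z).im ∨ (j = m + 1 ∧ z = ζ) := by
  obtain ⟨i, rfl⟩ : ∃ i, j = i + 1 := ⟨j - 1, by omega⟩
  have hz' := mul_mem_segment (c := c) hz
  rw [mul_spiralPt_succ h.one_lt] at hz'
  have ha := h.above i (by omega)
  have hb := (h.mul_upperEnd_mem hζ (j := i + 1)).1
  have hle : -1 ≤ (c * z).im := le_im_of_mem_segment hz' ha.le hb
  rcases hle.lt_or_eq with hlt | heq
  · exact Or.inl hlt
  · right
    have e := eq_right_of_im_eq hz' ha hb heq.symm
    have e' : z = upperEnd c m ζ (i + 1) := mul_left_cancel₀ (ne_zero_of_one_lt h.one_lt) e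
    rw [upperEnd] at e'
    split_ifs at e' with hi
    · have := h.above (i + 1) hi
      rw [e', mul_spiralPt_succ h.one_lt] at heq
      linarith
    · exact ⟨by omega, e'⟩

theorem upperEdge_im_le (h : Crossing c m t) (hζ : c * ζ = ⟨t, -1⟩) {j : ℕ} (h1 : 1 ≤ j)
    (hj : j ≤ m + 1) {z : ℂ} (hz : z ∈ upperEdge c m ζ j) : -1 ≤ (c * z).im := by
  rcases h.upperEdge_im hζ h1 hj hz with h2 | ⟨-, rfl⟩
  · exact h2.le
  · rw [hζ]

theorem upperEdge_line (h : Crossing c m t) (hζ : c * ζ = ⟨t, -1⟩) {j : ℕ}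
    (hj : j ≤ m + 1) {z : ℂ} (hz : z ∈ upperEdge c m ζ j) : (c ^ j * (c * z)).re = -tau c := by
  have hz' := mul_mem_segment (c := c) hz
  refine re_eq_of_mem_segment hz' ?_ ?_
  · rw [← mul_assoc, ← pow_succ, add_comm, pow_mul_spiralPt' h.one_lt, pow_one,
      c_mul_ell0_re h.one_lt]
  · rw [upperEnd]
    split_ifs with hjm
    · rw [mul_spiralPt_succ h.one_lt]
      exact h.pow_mul_pt_eq (Or.inl rfl)
    · obtain rfl : j = m + 1 := by omega
      rw [hζ]; exact h.last_line

theorem lt_pow_mul_startPt (h : Crossing c m t) {j k : ℕ} (hjk : j < k) (hk : k ≤ m + 1) :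
    -tau c < (c ^ k * startPt c j).re := by
  rcases j with _ | j
  · change -tau c < (c ^ k * (⟨-tau c, -1⟩ : ℂ)).re
    rcases Nat.lt_or_ge k (m + 1) with hk' | hk'
    · -- the midpoint of `c L_0` is the mean of a point on the inner side of the line and of
      -- one strictly on that side
      have h1 := (h.pt_mem (Nat.zero_le m)).2 k hk
      rw [spiralPt_zero] at h1
      have h2 := h.outer_pos (i := k) (by omega) (by omega)
      rw [mid_eq h.one_lt, mul_smul_comm, real_smul, re_ofReal_mul, mul_add, add_re,
        ← mul_assoc, ← pow_succ]
      linarith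
    · obtain rfl : k = m + 1 := le_antisymm hk hk'
      exact h.last_line_mid
  · exact h.lt_pow_mul_pt hk (by omega) (by omega) (by omega)

/-- Two upper edges meet at most in a common end point. -/
theorem upperEdge_inter (h : Crossing c m t) (hζ : c * ζ = ⟨t, -1⟩) {j k : ℕ} (hjk : j < k)
    (hk : k ≤ m + 1) {z : ℂ} (hzj : z ∈ upperEdge c m ζ j) (hzk : z ∈ upperEdge c m ζ k) :
    k = j + 1 ∧ z = spiralPt c (j + 1) := by
  have him := h.upperEdge_im_le hζ (by omega) hk hzk
  have hline := h.upperEdge_line hζ hk hzk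
  have hseg := h.mul_mem_segment_startPt hzj him
  have e : upperEnd c m ζ j = spiralPt c (j + 1) := by rw [upperEnd, if_pos (by omega)]
  rw [e] at hseg
  have hend : c * spiralPt c (j + 1) = spiralPt c j := mul_spiralPt_succ h.one_lt j
  have hz : c * z = c * spiralPt c (j + 1) := by
    refine eq_right_of_re_eq hseg (h.lt_pow_mul_startPt hjk hk) ?_ hline
    rw [hend]; exact (h.pt_mem (by omega)).2 k hk
  have hz' := mul_left_cancel₀ (ne_zero_of_one_lt h.one_lt) hz
  refine ⟨?_, hz'⟩
  by_contra hne
  have := h.lt_pow_mul_pt hk (j := j) (by omega) (by omega) hne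
  rw [hz, hend] at hline
  linarith

/-- A point of the convex polygon on the `k`-th line lies on the `k`-th edge. -/
theorem mem_upperEdge_of_line (h : Crossing c m t) (hζ : c * ζ = ⟨t, -1⟩) {k : ℕ}
    (hk : k ≤ m + 1) {z : ℂ} (hz : c * z ∈ halfImage c m)
    (hline : (c ^ k * (c * z)).re = -tau c) : z ∈ upperEdge c m ζ k := by
  have h0 := ne_zero_of_one_lt h.one_lt
  have hR := one_lt_normSq h.one_lt
  refine mem_segment_of_mul h0 ?_
  set w := c * z with hw
  set a := c * spiralPt c k with ha
  set b := c * upperEnd c m ζ k with hb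
  have hal : (c ^ k * a).re = -tau c := h.upperEdge_line hζ hk (left_mem_segment ℝ _ _)
  have hbl : (c ^ k * b).re = -tau c := h.upperEdge_line hζ hk (right_mem_segment ℝ _ _)
  -- the two functionals that bound the edge at its ends
  obtain ⟨u, hua, huw⟩ : ∃ u : ℂ, (u * a).re < (u * b).re ∧ (u * a).re ≤ (u * w).re := by
    rcases k with _ | i
    · refine ⟨-I, ?_, ?_⟩
      · have h1 := c_mul_ell0_im_lt h.one_lt h.im_pos
        have h2 := (h.mul_upperEnd_mem hζ (j := 0)).1
        rw [ha, spiralPt_zero]; rw [← hb] at h2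
        have e1 : ∀ v : ℂ, (-I * v).re = v.im := fun v => by simp
        rw [e1, e1]; linarith
      · have h1 := c_mul_ell0_im_lt h.one_lt h.im_pos
        have h2 := hz.1
        have e1 : ∀ v : ℂ, (-I * v).re = v.im := fun v => by simp
        rw [ha, spiralPt_zero, e1, e1]; linarith
    · have e2 : (c ^ i * a).re = -tau c := by
        rw [ha, mul_spiralPt_succ h.one_lt]; exact h.pow_mul_pt_eq (Or.inl rfl)
      refine ⟨c ^ i, ?_, ?_⟩
      · rw [e2]
        by_cases hi : i + 1 ≤ m
        · rw [hb, upperEnd, if_pos hi, mul_spiralPt_succ h.one_lt]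
          exact h.lt_pow_mul_pt (by omega) hi (by omega) (by omega)
        · obtain rfl : i = m := by omega
          rw [hb, upperEnd, if_neg hi, hζ]
          -- the point `c ζ` is on `c L_{m+1}`, and it is not the start of that segment
          have hend : -tau c < (c ^ i * spiralPt c (i + 1)).re := by
            have h1 := spiralPt_succ_re_sub h.one_lt 0
            have h2 : 0 < 2 * (normSq c + 1 - 2 * c.re) / (normSq c - 1) / normSq (c ^ (0 + 1)) *
                (c ^ (0 + 1)).im := by
              refine mul_pos (div_pos (spiral_step_pos h.one_lt h.im_pos) ?_) ?_
              · rw [normSq_pos]; exact pow_ne_zero _ h0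
              · simpa using h.im_pos
            rw [← h1, spiralPt_zero, ell0_re] at h2
            rw [pow_mul_spiralPt h.one_lt]
            linarith
          have hstart : (c ^ i * spiralPt c i).re = -tau c := h.pow_mul_pt_eq (Or.inl rfl)
          have hle : -tau c ≤ (c ^ i * (⟨t, -1⟩ : ℂ)).re := h.zeta_mem.2 i (by omega)
          rcases hle.lt_or_eq with hlt | heq
          · exact hlt
          · exfalso
            have hmem := h.mem
            rw [segment_symm] at hmem
            have := eq_right_of_re_eq hmem hend hstart.ge heq.symm
            have h3 := h.above i le_rfl
            rw [← this] at h3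
            simp at h3
      · rw [e2]; exact hz.2 i (by omega)
  obtain ⟨v, hva, hvw⟩ : ∃ v : ℂ, (v * b).re < (v * a).re ∧ (v * b).re ≤ (v * w).re := by
    by_cases hkm : k ≤ m
    · have e2 : b = spiralPt c k := by rw [hb, upperEnd, if_pos hkm, mul_spiralPt_succ h.one_lt]
      have e3 : (c ^ (k + 1) * b).re = -tau c := by
        rw [e2]; exact h.pow_mul_pt_eq (Or.inr rfl)
      refine ⟨c ^ (k + 1), ?_, ?_⟩
      · rw [e3, ha, ← mul_assoc, ← pow_succ, show k + 1 + 1 = 2 + k by ring,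
          pow_mul_spiralPt' h.one_lt]
        have h1 := pow_mul_ell0_re_sub h.one_lt c
        rw [c_mul_ell0_re h.one_lt] at h1
        have h2 := mul_pos (spiral_step_pos h.one_lt h.im_pos) h.im_pos
        rw [sq]; linarith
      · rw [e3]; exact hz.2 _ (by omega)
    · obtain rfl : k = m + 1 := by omega
      have e1 : ∀ v : ℂ, (-I * v).re = v.im := fun v => by simp
      have e2 : b = ⟨t, -1⟩ := by rw [hb, upperEnd, if_neg hkm, hζ]
      refine ⟨-I, ?_, ?_⟩
      · rw [e1, e1, e2, ha, mul_spiralPt_succ h.one_lt]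
        exact h.above m le_rfl
      · rw [e1, e1, e2]; exact hz.1
  -- `w` is on the line through `a` and `b`
  have hne : b - a ≠ 0 := by
    intro h1
    rw [sub_eq_zero.1 h1] at hua
    exact lt_irrefl _ hua
  have hck : c ^ k ≠ 0 := pow_ne_zero _ h0
  obtain ⟨s, hs⟩ : ∃ s : ℝ, w = a + (s : ℂ) * (b - a) := by
    refine ⟨((c ^ k * (w - a)) / (c ^ k * (b - a))).re, ?_⟩
    have hx : (c ^ k * (w - a)).re = 0 := by rw [mul_sub, sub_re, hline, hal]; ring
    have hy : (c ^ k * (b - a)).re = 0 := by rw [mul_sub, sub_re, hbl, hal]; ring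
    have him : ((c ^ k * (w - a)) / (c ^ k * (b - a))).im = 0 := by
      rw [div_im, hx, hy]; ring
    have hreal : (((c ^ k * (w - a)) / (c ^ k * (b - a))).re : ℂ) =
        (c ^ k * (w - a)) / (c ^ k * (b - a)) := by
      apply Complex.ext
      · simp only [ofReal_re]
      · rw [ofReal_im, him]
    rw [hreal, mul_div_mul_left _ _ hck, div_mul_cancel₀ _ hne]; ring
  have hlin : ∀ q : ℂ, (q * w).re = (q * a).re + s * ((q * b).re - (q * a).re) := by
    intro q
    rw [hs, mul_add, add_re, show q * ((s : ℂ) * (b - a)) = s * (q * b - q * a) by ring,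
      re_ofReal_mul, sub_re]
  have hs0 : 0 ≤ s := by
    rw [hlin u] at huw
    by_contra! hneg
    nlinarith
  have hs1 : s ≤ 1 := by
    rw [hlin v] at hvw
    by_contra! hneg
    nlinarith
  refine ⟨1 - s, s, by linarith, hs0, by ring, ?_⟩
  rw [hs, real_smul, real_smul]; push_cast; ring

end Crossing

/-! ### The outer-most boundary as a simple closed polygon -/

/-- The vertices of the outer-most boundary in cyclic order:
`ℓ_{-m}, …, ℓ_{m+1}, ζ`, where `n = m + 1`. -/
noncomputable def bdryVertex (c : ℂ) (m : ℕ) (ζ : ℂ) (i : ℕ) : ℂ :=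
  if i = 2 * m + 2 then ζ else ell c ((i : ℤ) - m)

/-- The closed polygon with these `2 n + 1 = 2 m + 3` vertices. -/
noncomputable def bdryPolygon (c : ℂ) (m : ℕ) (ζ : ℂ) : Polygon ℂ (2 * m + 3) :=
  ⟨fun i => bdryVertex c m ζ i⟩

theorem bdryVertex_upper (c : ℂ) {m : ℕ} (ζ : ℂ) {j : ℕ} (hj : j ≤ m + 1) :
    bdryVertex c m ζ (m + j) = spiralPt c j := by
  rw [bdryVertex, if_neg (by omega), ← ell_natCast]
  congr 1; push_cast; ring

theorem bdryVertex_lower {c : ℂ} (hc : 1 < ‖c‖) {m : ℕ} (ζ : ℂ) {i j : ℕ} (h : i + j = m) :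
    bdryVertex c m ζ i = reflPFL c (spiralPt c (j + 1)) := by
  rw [bdryVertex, if_neg (by omega), ← ell_neg c hc]
  congr 1; omega

theorem bdryVertex_last (c : ℂ) (m : ℕ) (ζ : ℂ) : bdryVertex c m ζ (2 * m + 2) = ζ := if_pos rfl

theorem finRotate_val (m : ℕ) (i : Fin (2 * m + 3)) :
    ((finRotate (2 * m + 3) i : Fin (2 * m + 3)) : ℕ) =
      if (i : ℕ) = 2 * m + 2 then 0 else (i : ℕ) + 1 := by
  rw [finRotate_apply, Fin.val_add_one]
  simp only [Fin.ext_iff, Fin.val_last]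

/-- Each edge of the boundary polygon is an upper edge `j`, with index `m + j`, or the mirror image
of one, traversed backwards, with index `m - j` (or the last index, for `j = m + 1`). -/
theorem bdryPolygon_edge {c : ℂ} (hc : 1 < ‖c‖) {m : ℕ} {ζ : ℂ} (hζ : reflPFL c ζ = ζ)
    (i : Fin (2 * m + 3)) :
    ∃ j ≤ m + 1,
      ((i : ℕ) = m + j ∧ bdryVertex c m ζ i = spiralPt c j ∧
        bdryVertex c m ζ (finRotate (2 * m + 3) i : Fin (2 * m + 3)) = upperEnd c m ζ j) ∨
      (1 ≤ j ∧ ((i : ℕ) + j = m ∨ ((i : ℕ) = 2 * m + 2 ∧ j = m + 1)) ∧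
        bdryVertex c m ζ i = reflPFL c (upperEnd c m ζ j) ∧
        bdryVertex c m ζ (finRotate (2 * m + 3) i : Fin (2 * m + 3)) =
          reflPFL c (spiralPt c j)) := by
  have hi := i.2
  rw [finRotate_val]
  rcases Nat.lt_or_ge (i : ℕ) m with h1 | h1
  · refine ⟨m - i, by omega, Or.inr ⟨by omega, Or.inl (by omega), ?_, ?_⟩⟩
    · rw [bdryVertex_lower hc ζ (j := m - i) (by omega), upperEnd, if_pos (by omega)]
    · obtain ⟨k, hk⟩ : ∃ k, m - (i : ℕ) = k + 1 := ⟨m - i - 1, by omega⟩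
      rw [if_neg (by omega), bdryVertex_lower hc ζ (j := k) (by omega), hk]
  · rcases Nat.lt_or_ge (i : ℕ) (2 * m + 2) with h2 | h2
    · obtain ⟨j, hj⟩ := Nat.exists_eq_add_of_le h1
      refine ⟨j, by omega, Or.inl ⟨hj, ?_, ?_⟩⟩
      · rw [hj, bdryVertex_upper c ζ (by omega)]
      · rw [if_neg (by omega), upperEnd, hj]
        split_ifs with h3
        · rw [add_assoc, bdryVertex_upper c ζ (by omega)]
        · rw [show m + j + 1 = 2 * m + 2 by omega, bdryVertex_last]
    · have h3 : (i : ℕ) = 2 * m + 2 := by omega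
      refine ⟨m + 1, le_rfl, Or.inr ⟨by omega, Or.inr ⟨h3, rfl⟩, ?_, ?_⟩⟩
      · rw [h3, bdryVertex_last, upperEnd, if_neg (by omega), hζ]
      · rw [if_pos h3, bdryVertex_lower hc ζ (j := m) (by omega)]

theorem bdryPolygon_edgeSet {c : ℂ} {m : ℕ} {ζ : ℂ} (i : Fin (2 * m + 3)) :
    (bdryPolygon c m ζ).edgeSet ℝ i = segment ℝ (bdryVertex c m ζ i)
      (bdryVertex c m ζ (finRotate (2 * m + 3) i : Fin (2 * m + 3))) := by
  rw [Polygon.edgeSet, affineSegment_eq_segment]; rfl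

theorem Lseg_natCast (c : ℂ) (j : ℕ) :
    Lseg c (j : ℤ) = segment ℝ (spiralPt c j) (spiralPt c (j + 1)) := by
  rw [Lseg, ← ell_natCast, ← ell_natCast]; push_cast; rfl

theorem mem_Lseg_neg {c : ℂ} (hc : 1 < ‖c‖) (j : ℕ) (z : ℂ) :
    z ∈ Lseg c (-((j + 1 : ℕ) : ℤ)) ↔
      reflPFL c z ∈ segment ℝ (spiralPt c (j + 1)) (spiralPt c (j + 1 + 1)) := by
  have e : -((j + 1 : ℕ) : ℤ) + 1 = -(j : ℤ) := by push_cast; ring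
  rw [Lseg, e, ell_neg c hc, ell_neg c hc, segment_symm, mem_segment_reflPFL_iff hc]

namespace Crossing

variable {c : ℂ} {m : ℕ} {t : ℝ} {ζ : ℂ}

theorem reflPFL_zeta (h : Crossing c m t) (hζ : c * ζ = ⟨t, -1⟩) : reflPFL c ζ = ζ :=
  reflPFL_eq_self h.one_lt (by rw [hζ])

theorem mem_ends_of_lt (h : Crossing c m t) (hζ : c * ζ = ⟨t, -1⟩) {j k : ℕ} (hjk : j < k)
    (hk : k ≤ m + 1) {z : ℂ} (hzj : z ∈ upperEdge c m ζ j) (hzk : z ∈ upperEdge c m ζ k) :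
    z ∈ ({spiralPt c j, upperEnd c m ζ j} ∩ {spiralPt c k, upperEnd c m ζ k} : Set ℂ) := by
  obtain ⟨rfl, rfl⟩ := h.upperEdge_inter hζ hjk hk hzj hzk
  refine ⟨Or.inr ?_, Or.inl rfl⟩
  change _ = upperEnd c m ζ j
  rw [upperEnd, if_pos (by omega)]

theorem mem_ends_of_ne (h : Crossing c m t) (hζ : c * ζ = ⟨t, -1⟩) {j k : ℕ} (hjk : j ≠ k)
    (hj : j ≤ m + 1) (hk : k ≤ m + 1) {z : ℂ} (hzj : z ∈ upperEdge c m ζ j)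
    (hzk : z ∈ upperEdge c m ζ k) :
    z ∈ ({spiralPt c j, upperEnd c m ζ j} ∩ {spiralPt c k, upperEnd c m ζ k} : Set ℂ) := by
  rcases lt_or_gt_of_ne hjk with h1 | h1
  · exact h.mem_ends_of_lt hζ h1 hk hzj hzk
  · exact (h.mem_ends_of_lt hζ h1 hj hzk hzj).symm

/-- An upper edge and the mirror image of another one meet at most in common end points. -/
theorem mem_ends_of_mirror (h : Crossing c m t) (hζ : c * ζ = ⟨t, -1⟩) {j k : ℕ}
    (hj : j ≤ m + 1) (hk0 : 1 ≤ k) (hk : k ≤ m + 1) {z : ℂ} (hzj : z ∈ upperEdge c m ζ j)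
    (hzk : reflPFL c z ∈ upperEdge c m ζ k) :
    z ∈ ({spiralPt c j, upperEnd c m ζ j} : Set ℂ) ∧
      reflPFL c z ∈ ({spiralPt c k, upperEnd c m ζ k} : Set ℂ) := by
  have hE : upperEnd c m ζ (m + 1) = ζ := by rw [upperEnd, if_neg (by omega)]
  have him := h.upperEdge_im hζ hk0 hk hzk
  rcases Nat.eq_zero_or_pos j with rfl | hj0
  · -- `L_0` is its own mirror image
    have e1 : upperEnd c m ζ 0 = spiralPt c 1 := by rw [upperEnd, if_pos (Nat.zero_le _)]
    have e0 : reflPFL c (spiralPt c 1) = spiralPt c 0 := by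
      rw [reflPFL_ell_one h.one_lt, spiralPt_zero]
    have e0' : reflPFL c (spiralPt c 0) = spiralPt c 1 := by
      rw [← e0, reflPFL_reflPFL h.one_lt]
    have hz' : reflPFL c z ∈ upperEdge c m ζ 0 := by
      have := reflPFL_mem_segment h.one_lt hzj
      rw [e1, e0, e0', segment_symm] at this
      rwa [upperEdge, e1]
    obtain ⟨h1, h2⟩ := h.mem_ends_of_lt hζ (by omega) hk hz' hzk
    refine ⟨?_, h2⟩
    rw [e1] at h1 ⊢
    rcases h1 with h1 | h1
    · right
      change z = _
      rw [← reflPFL_reflPFL h.one_lt z, h1, e0']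
    · left
      have h1' : reflPFL c z = spiralPt c 1 := h1
      rw [← reflPFL_reflPFL h.one_lt z, h1', e0]
  · have him' := h.upperEdge_im hζ hj0 hj hzj
    rw [mul_reflPFL_im h.one_lt] at him
    have hz1 := h.upperEdge_im_le hζ hj0 hj hzj
    have hz2 := h.upperEdge_im_le hζ hk0 hk hzk
    rw [mul_reflPFL_im h.one_lt] at hz2
    rcases him' with h1 | ⟨rfl, h1⟩
    · linarith
    · rcases him with h2 | ⟨rfl, h2⟩
      · linarith
      · rw [hE]; exact ⟨Or.inr h1, Or.inr h2⟩

theorem bdryPolygon_inter (h : Crossing c m t) (hζ : c * ζ = ⟨t, -1⟩) {i i' : Fin (2 * m + 3)}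
    (hii : i ≠ i') {z : ℂ} (hz : z ∈ (bdryPolygon c m ζ).edgeSet ℝ i)
    (hz' : z ∈ (bdryPolygon c m ζ).edgeSet ℝ i') :
    z ∈ ({bdryVertex c m ζ i,
      bdryVertex c m ζ (finRotate (2 * m + 3) i : Fin (2 * m + 3))} : Set ℂ) := by
  have hne : (i : ℕ) ≠ i' := fun e => hii (Fin.ext e)
  have hrefl : ∀ {a : ℂ}, reflPFL c z = a → z = reflPFL c a := fun {a} e => by
    rw [← e, reflPFL_reflPFL h.one_lt]
  rw [bdryPolygon_edgeSet] at hz hz'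
  obtain ⟨j, hj, hcase⟩ := bdryPolygon_edge h.one_lt (h.reflPFL_zeta hζ) i
  obtain ⟨k, hk, hcase'⟩ := bdryPolygon_edge h.one_lt (h.reflPFL_zeta hζ) i'
  rcases hcase with ⟨hi, e1, e2⟩ | ⟨hj0, hi, e1, e2⟩ <;>
    rcases hcase' with ⟨hi', e1', e2'⟩ | ⟨hk0, hi', e1', e2'⟩ <;>
    rw [e1, e2] at hz ⊢ <;> rw [e1', e2'] at hz'
  · exact (h.mem_ends_of_ne hζ (by omega) hj hk hz hz').1
  · rw [segment_symm, mem_segment_reflPFL_iff h.one_lt] at hz'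
    exact (h.mem_ends_of_mirror hζ hj hk0 hk hz hz').1
  · rw [segment_symm, mem_segment_reflPFL_iff h.one_lt] at hz
    rcases (h.mem_ends_of_mirror hζ hk hj0 hj hz' hz).2 with e | e
    · exact Or.inr (hrefl e)
    · exact Or.inl (hrefl e)
  · rw [segment_symm, mem_segment_reflPFL_iff h.one_lt] at hz hz'
    rcases (h.mem_ends_of_ne hζ (by omega) hj hk hz hz').1 with e | e
    · exact Or.inr (hrefl e)
    · exact Or.inl (hrefl e)

theorem spiralPt_injective (h : Crossing c m t) : Function.Injective (spiralPt c) := by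
  intro j k hjk
  have h0 := ne_zero_of_one_lt h.one_lt
  have he : ell0 c ≠ 0 := by
    intro h1
    have h2 := tau_pos h.one_lt h.im_pos
    have := ell0_re c
    rw [h1] at this
    simp at this; linarith
  rw [spiralPt, spiralPt, div_eq_div_iff (pow_ne_zero _ h0) (pow_ne_zero _ h0)] at hjk
  have := congrArg norm (mul_left_cancel₀ he hjk).symm
  rw [norm_pow, norm_pow] at this
  exact pow_right_injective₀ (by linarith [h.one_lt]) h.one_lt.ne' this

theorem bdryVertex_injective (h : Crossing c m t) (hζ : c * ζ = ⟨t, -1⟩) :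
    Function.Injective (bdryPolygon c m ζ).vertices := by
  have key : ∀ i : Fin (2 * m + 3),
      (∃ j ≤ m, (i : ℕ) = m + 1 + j ∧ bdryVertex c m ζ i = spiralPt c (j + 1) ∧
        -1 < (c * bdryVertex c m ζ i).im) ∨
      (∃ j ≤ m, (i : ℕ) + j = m ∧ bdryVertex c m ζ i = reflPFL c (spiralPt c (j + 1)) ∧
        (c * bdryVertex c m ζ i).im < -1) ∨
      ((i : ℕ) = 2 * m + 2 ∧ (c * bdryVertex c m ζ i).im = -1) := by
    intro i
    have hi := i.2
    have hup : ∀ j ≤ m, -1 < (c * spiralPt c (j + 1)).im := fun j hj => by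
      rw [mul_spiralPt_succ h.one_lt]; exact h.above j hj
    rcases Nat.lt_or_ge m (i : ℕ) with h1 | h1
    · rcases Nat.lt_or_ge (i : ℕ) (2 * m + 2) with h2 | h2
      · left
        obtain ⟨j, hj⟩ := Nat.exists_eq_add_of_lt h1
        have e : bdryVertex c m ζ i = spiralPt c (j + 1) := by
          rw [hj, add_assoc, bdryVertex_upper c ζ (by omega)]
        exact ⟨j, by omega, by omega, e, by rw [e]; exact hup j (by omega)⟩
      · right; right
        have h3 : (i : ℕ) = 2 * m + 2 := by omega
        exact ⟨h3, by rw [h3, bdryVertex_last, hζ]⟩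
    · right; left
      have e := bdryVertex_lower h.one_lt (m := m) ζ (i := i) (j := m - i) (by omega)
      refine ⟨m - i, by omega, by omega, e, ?_⟩
      rw [e, mul_reflPFL_im h.one_lt]
      linarith [hup (m - i) (by omega)]
  intro i i' hii
  have hii' : bdryVertex c m ζ i = bdryVertex c m ζ i' := hii
  apply Fin.ext
  rcases key i with ⟨j, hj, hi, e, him⟩ | ⟨j, hj, hi, e, him⟩ | ⟨hi, him⟩ <;>
    rcases key i' with ⟨k, hk, hi', e', him'⟩ | ⟨k, hk, hi', e', him'⟩ | ⟨hi', him'⟩ <;>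
    rw [hii'] at him
  any_goals linarith
  · have := h.spiralPt_injective (e.symm.trans (hii'.trans e'))
    omega
  · have h1 := e.symm.trans (hii'.trans e')
    have h2 := congrArg (reflPFL c) h1
    rw [reflPFL_reflPFL h.one_lt, reflPFL_reflPFL h.one_lt] at h2
    have := h.spiralPt_injective h2
    omega

theorem isSimplePolygon (h : Crossing c m t) (hζ : c * ζ = ⟨t, -1⟩) :
    IsSimplePolygon (bdryPolygon c m ζ) := by
  refine ⟨by omega, h.bdryVertex_injective hζ, fun i i' hii z hz => ?_⟩
  exact ⟨h.bdryPolygon_inter hζ hii hz.1 hz.2, h.bdryPolygon_inter hζ hii.symm hz.2 hz.1⟩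

/-- The boundary polygon consists of the upper edges and their mirror images. -/
theorem mem_boundary_iff (h : Crossing c m t) (hζ : c * ζ = ⟨t, -1⟩) (z : ℂ) :
    z ∈ (bdryPolygon c m ζ).boundary ℝ ↔
      ∃ j ≤ m + 1, z ∈ upperEdge c m ζ j ∨ (1 ≤ j ∧ reflPFL c z ∈ upperEdge c m ζ j) := by
  rw [Polygon.boundary, Set.mem_iUnion]
  simp only [bdryPolygon_edgeSet]
  constructor
  · rintro ⟨i, hi⟩
    obtain ⟨j, hj, ⟨-, e1, e2⟩ | ⟨hj0, -, e1, e2⟩⟩ :=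
      bdryPolygon_edge h.one_lt (h.reflPFL_zeta hζ) i <;> rw [e1, e2] at hi
    · exact ⟨j, hj, Or.inl hi⟩
    · rw [segment_symm, mem_segment_reflPFL_iff h.one_lt] at hi
      exact ⟨j, hj, Or.inr ⟨hj0, hi⟩⟩
  · rintro ⟨j, hj, hz | ⟨hj0, hz⟩⟩
    · refine ⟨⟨m + j, by omega⟩, ?_⟩
      obtain ⟨k, hk, ⟨hi, e1, e2⟩ | ⟨hk0, hi, e1, e2⟩⟩ :=
        bdryPolygon_edge h.one_lt (m := m) (h.reflPFL_zeta hζ) ⟨m + j, by omega⟩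
      · simp only at hi
        obtain rfl : j = k := by omega
        rw [e1, e2]; exact hz
      · simp only at hi; omega
    · have hex : ∃ i : Fin (2 * m + 3), (i : ℕ) + j = m ∨ ((i : ℕ) = 2 * m + 2 ∧ j = m + 1) := by
        rcases Nat.lt_or_ge m j with h1 | h1
        · exact ⟨⟨2 * m + 2, by omega⟩, Or.inr ⟨rfl, by omega⟩⟩
        · exact ⟨⟨m - j, by omega⟩, Or.inl (by simp only; omega)⟩
      obtain ⟨i, hi⟩ := hex
      refine ⟨i, ?_⟩
      obtain ⟨k, hk, ⟨hi', e1, e2⟩ | ⟨hk0, hi', e1, e2⟩⟩ :=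
        bdryPolygon_edge h.one_lt (h.reflPFL_zeta hζ) i
      · omega
      · obtain rfl : j = k := by omega
        rw [e1, e2, segment_symm, mem_segment_reflPFL_iff h.one_lt]; exact hz

theorem mem_outerBoundary_iff (h : Crossing c m t) (hζ : c * ζ = ⟨t, -1⟩) (z : ℂ) :
    z ∈ outerBoundary c (m + 1) ζ ↔
      ∃ j ≤ m + 1, z ∈ upperEdge c m ζ j ∨ (1 ≤ j ∧ reflPFL c z ∈ upperEdge c m ζ j) := by
  have hlast : upperEdge c m ζ (m + 1) = segment ℝ (spiralPt c (m + 1)) ζ := by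
    rw [upperEdge, upperEnd, if_neg (by omega)]
  have hedge : ∀ j ≤ m, upperEdge c m ζ j = segment ℝ (spiralPt c j) (spiralPt c (j + 1)) :=
    fun j hj => by rw [upperEdge, upperEnd, if_pos hj]
  have e1 : ell c ((m + 1 : ℕ) : ℤ) = spiralPt c (m + 1) := ell_natCast c (m + 1)
  have e2 : ell c (-(((m + 1 : ℕ) : ℤ) - 1)) = reflPFL c (spiralPt c (m + 1)) := by
    rw [← ell_neg c h.one_lt]; congr 1; push_cast; ring
  have e3 : z ∈ segment ℝ (reflPFL c (spiralPt c (m + 1))) ζ ↔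
      reflPFL c z ∈ upperEdge c m ζ (m + 1) := by
    rw [hlast, ← mem_segment_reflPFL_iff h.one_lt, h.reflPFL_zeta hζ]
  rw [outerBoundary, e1, e2, Set.mem_union, Set.mem_union, e3, ← hlast, Set.mem_iUnion₂]
  constructor
  · rintro ((hz | hz) | ⟨k, hk, hz⟩)
    · exact ⟨m + 1, le_rfl, Or.inl hz⟩
    · exact ⟨m + 1, le_rfl, Or.inr ⟨by omega, hz⟩⟩
    · have hk' : |k| ≤ (((m + 1 : ℕ) : ℤ) - 1) := hk
      rw [abs_le] at hk'
      push_cast at hk'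
      rcases le_or_gt 0 k with h1 | h1
      · obtain ⟨j, rfl⟩ := Int.eq_ofNat_of_zero_le h1
        have hj : j ≤ m := by omega
        rw [Lseg_natCast, ← hedge j hj] at hz
        exact ⟨j, by omega, Or.inl hz⟩
      · obtain ⟨j, rfl⟩ : ∃ j : ℕ, k = -((j + 1 : ℕ) : ℤ) := ⟨(-k - 1).toNat, by omega⟩
        have hj : j + 1 ≤ m := by omega
        rw [mem_Lseg_neg h.one_lt, ← hedge _ hj] at hz
        exact ⟨j + 1, by omega, Or.inr ⟨by omega, hz⟩⟩
  · rintro ⟨j, hj, hz⟩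
    rcases Nat.lt_or_ge m j with h1 | h1
    · obtain rfl : j = m + 1 := by omega
      rcases hz with hz | ⟨-, hz⟩
      · exact Or.inl (Or.inl hz)
      · exact Or.inl (Or.inr hz)
    · right
      rcases hz with hz | ⟨hj0, hz⟩
      · refine ⟨(j : ℤ), ?_, ?_⟩
        · change |(j : ℤ)| ≤ _
          rw [abs_le]; push_cast; constructor <;> omega
        · rw [Lseg_natCast, ← hedge j h1]; exact hz
      · obtain ⟨i, rfl⟩ : ∃ i, j = i + 1 := ⟨j - 1, by omega⟩
        refine ⟨-((i + 1 : ℕ) : ℤ), ?_, ?_⟩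
        · change |(-((i + 1 : ℕ) : ℤ))| ≤ _
          rw [abs_le]; push_cast; constructor <;> omega
        · rw [mem_Lseg_neg h.one_lt, ← hedge _ h1]; exact hz

/-- The outer-most boundary consists of the points of the solid polygon that the map sends to
one of the lines bounding `halfImage c m`, apart from the folding line. -/
theorem mem_outerBoundary_iff_line (h : Crossing c m t) (hζ : c * ζ = ⟨t, -1⟩) (z : ℂ) :
    z ∈ outerBoundary c (m + 1) ζ ↔
      z ∈ solid c m ∧ ∃ k ≤ m + 1, (c ^ k * f c z).re = -tau c := by
  have hf : f c (reflPFL c z) = f c z := by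
    rw [f_eq_mul_up h.one_lt, up_reflPFL h.one_lt, ← f_eq_mul_up h.one_lt]
  rw [h.mem_outerBoundary_iff hζ]
  constructor
  · have key : ∀ x : ℂ, ∀ j ≤ m + 1, x ∈ upperEdge c m ζ j → -1 ≤ (c * x).im →
        f c x ∈ halfImage c m ∧ (c ^ j * f c x).re = -tau c := by
      intro x j hj hx him
      rw [f_of_ge him]
      exact ⟨h.mul_mem_of_mem_upperEdge hζ hj hx him, h.upperEdge_line hζ hj hx⟩
    rintro ⟨j, hj, hz | ⟨hj0, hz⟩⟩
    · rcases le_or_gt (-1) (c * z).im with him | him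
      · exact ⟨(key z j hj hz him).1, j, hj, (key z j hj hz him).2⟩
      · rcases Nat.eq_zero_or_pos j with rfl | hj0
        · have e1 : upperEnd c m ζ 0 = spiralPt c 1 := by rw [upperEnd, if_pos (Nat.zero_le _)]
          have e0 : reflPFL c (spiralPt c 1) = spiralPt c 0 := by
            rw [reflPFL_ell_one h.one_lt, spiralPt_zero]
          have hz' : reflPFL c z ∈ upperEdge c m ζ 0 := by
            have := reflPFL_mem_segment h.one_lt hz
            rw [e1, ← e0, reflPFL_reflPFL h.one_lt, e0, segment_symm] at this
            rwa [upperEdge, e1]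
          have h2 := key _ 0 hj hz' (by rw [mul_reflPFL_im h.one_lt]; linarith)
          rw [hf] at h2
          exact ⟨h2.1, 0, hj, h2.2⟩
        · linarith [h.upperEdge_im_le hζ hj0 hj hz]
    · have h2 := key _ j hj hz (h.upperEdge_im_le hζ hj0 hj hz)
      rw [hf] at h2
      exact ⟨h2.1, j, hj, h2.2⟩
  · rintro ⟨hz, k, hk, hline⟩
    have hz' : f c z ∈ halfImage c m := hz
    rw [f_eq_mul_up h.one_lt] at hz' hline
    have hmem := h.mem_upperEdge_of_line hζ hk hz' hline
    rcases le_total (-1) (c * z).im with him | him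
    · rw [up_of_mem him] at hmem
      exact ⟨k, hk, Or.inl hmem⟩
    · rw [up_of_le h.one_lt him] at hmem
      rcases Nat.eq_zero_or_pos k with rfl | hk0
      · have e1 : upperEnd c m ζ 0 = spiralPt c 1 := by rw [upperEnd, if_pos (Nat.zero_le _)]
        have e0 : reflPFL c (spiralPt c 1) = spiralPt c 0 := by
          rw [reflPFL_ell_one h.one_lt, spiralPt_zero]
        have := reflPFL_mem_segment h.one_lt hmem
        rw [e1, ← e0, reflPFL_reflPFL h.one_lt, reflPFL_reflPFL h.one_lt, e0, segment_symm] at this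
        exact ⟨0, hk, Or.inl (by rwa [upperEdge, e1])⟩
      · exact ⟨k, hk, Or.inr ⟨hk0, hmem⟩⟩

/-! ### The enclosed region -/

theorem isBounded_solid (h : Crossing c m t) : Bornology.IsBounded (solid c m) := by
  obtain ⟨M, hM⟩ := h.isBounded_halfImage.exists_norm_le
  refine (Metric.isBounded_closedBall (x := (0 : ℂ)) (r := M + 2)).subset fun z hz => ?_
  have h1 := hM _ (show f c z ∈ halfImage c m from hz)
  rw [mem_closedBall_zero_iff]
  have h2 : ‖z‖ ≤ ‖c * z‖ := by
    rw [norm_mul]; exact le_mul_of_one_le_left (norm_nonneg _) h.one_lt.le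
  have h3 : ‖c * z‖ ≤ ‖f c z‖ + 2 := by
    unfold f
    split_ifs
    · linarith
    · have := norm_le_norm_add_norm_sub' ((starRingEnd ℂ) (c * z)) (2 * I)
      rw [RCLike.norm_conj, norm_mul 2 I] at this
      simp at this ⊢
      linarith
  linarith

/-- The complement of the solid polygon contains, with each point, the ray from that point
away from the midpoint `m_0` of `L_0`. -/
theorem ray_not_mem (h : Crossing c m t) {m₀ z : ℂ} (hm₀ : c * m₀ = ⟨-tau c, -1⟩)
    (hz : z ∉ solid c m) {s : ℝ} (hs : 0 ≤ s) : (1 + s) • z + (-s) • m₀ ∉ solid c m := by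
  have hf : ∀ x, f c (reflPFL c x) = f c x := fun x => by
    rw [f_eq_mul_up h.one_lt, up_reflPFL h.one_lt, ← f_eq_mul_up h.one_lt]
  have key : ∀ x : ℂ, -1 ≤ (c * x).im → x ∉ solid c m → (1 + s) • x + (-s) • m₀ ∉ solid c m := by
    intro x hx hxs hmem
    have e : c * ((1 + s) • x + (-s) • m₀) = (1 + s) • (c * x) + (-s) • (⟨-tau c, -1⟩ : ℂ) := by
      rw [mul_add, mul_smul_comm, mul_smul_comm, hm₀]
    have him : -1 ≤ (c * ((1 + s) • x + (-s) • m₀)).im := by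
      rw [e, add_im, real_smul, real_smul, im_ofReal_mul, im_ofReal_mul]
      nlinarith
    have hmem' : f c ((1 + s) • x + (-s) • m₀) ∈ halfImage c m := hmem
    rw [f_of_ge him, e] at hmem'
    refine hxs ?_
    change f c x ∈ halfImage c m
    rw [f_of_ge hx]
    refine ⟨hx, fun k hk => ?_⟩
    have h1 := hmem'.2 k hk
    have h2 := h.mid_mem.2 k hk
    rw [mul_add, mul_smul_comm, mul_smul_comm, add_re, real_smul, real_smul, re_ofReal_mul,
      re_ofReal_mul] at h1
    by_contra! h3
    nlinarith
  rcases le_total (-1) (c * z).im with him | him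
  · exact key z him hz
  · intro hmem
    have hm₀r : reflPFL c m₀ = m₀ := reflPFL_eq_self h.one_lt (by rw [hm₀])
    refine key (reflPFL c z) (by rw [mul_reflPFL_im h.one_lt]; linarith) ?_ ?_
    · intro h1
      have h2 := reflPFL_mem_solid h.one_lt h1
      rw [reflPFL_reflPFL h.one_lt] at h2
      exact hz h2
    · have := reflPFL_mem_solid h.one_lt hmem
      rwa [reflPFL_combo h.one_lt (by ring), hm₀r] at this

theorem not_isBounded_component (h : Crossing c m t) {B : Set ℂ} (hB : B ⊆ solid c m) {z : ℂ}
    (hz : z ∉ solid c m) : ¬ Bornology.IsBounded (connectedComponentIn Bᶜ z) := by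
  intro hbdd
  set m₀ : ℂ := ⟨-tau c, -1⟩ / c with hm₀def
  have hm₀ : c * m₀ = ⟨-tau c, -1⟩ := mul_div_cancel₀ _ (ne_zero_of_one_lt h.one_lt)
  set ρ : ℝ → ℂ := fun s => (1 + s) • z + (-s) • m₀ with hρ
  have hcont : Continuous ρ := by rw [hρ]; fun_prop
  have hpre : IsPreconnected (ρ '' Set.Ici 0) :=
    isPreconnected_Ici.image _ hcont.continuousOn
  have hz0 : z ∈ ρ '' Set.Ici 0 := ⟨0, Set.self_mem_Ici, by simp [hρ]⟩
  have hsub : ρ '' Set.Ici 0 ⊆ Bᶜ := by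
    rintro _ ⟨s, hs, rfl⟩ hmem
    exact h.ray_not_mem hm₀ hz hs (hB hmem)
  have hb := hbdd.subset (hpre.subset_connectedComponentIn hz0 hsub)
  obtain ⟨M, hM⟩ := hb.exists_norm_le
  have hne : z - m₀ ≠ 0 := by
    intro h0
    refine hz ?_
    rw [sub_eq_zero.1 h0]
    change f c m₀ ∈ halfImage c m
    rw [f_of_ge (by rw [hm₀]), hm₀]
    exact h.mid_mem
  have hpos : 0 < ‖z - m₀‖ := norm_pos_iff.2 hne
  have hM0 : 0 ≤ M := (norm_nonneg z).trans (hM z hz0)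
  set s := (M + ‖z‖ + 1) / ‖z - m₀‖ with hs
  have hs0 : 0 ≤ s := by positivity
  have h1 := hM (ρ s) ⟨s, hs0, rfl⟩
  have e : s • (z - m₀) = ρ s - z := by rw [hρ]; module
  have h2 : ‖s • (z - m₀)‖ = M + ‖z‖ + 1 := by
    rw [norm_smul, Real.norm_of_nonneg hs0, hs, div_mul_cancel₀ _ hpos.ne']
  have h3 := norm_sub_le (ρ s) z
  rw [← e, h2] at h3
  linarith

theorem isPolygonBoundedBy (h : Crossing c m t) (hζ : c * ζ = ⟨t, -1⟩) :
    IsPolygonBoundedBy (solid c m) (outerBoundary c (m + 1) ζ) := by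
  refine ⟨⟨2 * m + 3, bdryPolygon c m ζ, h.isSimplePolygon hζ, ?_⟩, ?_⟩
  · ext z
    rw [h.mem_boundary_iff hζ, h.mem_outerBoundary_iff hζ]
  · have hB : outerBoundary c (m + 1) ζ ⊆ solid c m := fun z hz =>
      ((h.mem_outerBoundary_iff_line hζ z).1 hz).1
    -- the open polygon
    set U : Set ℂ := ⋂ k ∈ Set.Iic (m + 1), {z | -tau c < (c ^ k * f c z).re} with hU
    have hUo : IsOpen U := by
      refine (Set.finite_Iic (m + 1)).isOpen_biInter fun k _ => isOpen_lt continuous_const ?_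
      exact continuous_re.comp (continuous_const.mul (continuous_f h.one_lt))
    have hUs : U ⊆ solid c m := by
      intro z hz
      refine ⟨f_im h.one_lt z, fun k hk => ?_⟩
      exact le_of_lt (Set.mem_iInter₂.1 hz k hk)
    have hcover : (outerBoundary c (m + 1) ζ)ᶜ ⊆ U ∪ (solid c m)ᶜ := by
      intro z hz
      by_cases hzs : z ∈ solid c m
      · left
        refine Set.mem_iInter₂.2 fun k hk => ?_
        have hzs' : f c z ∈ halfImage c m := hzs
        refine lt_of_le_of_ne (hzs'.2 k hk) fun e => ?_
        exact hz ((h.mem_outerBoundary_iff_line hζ z).2 ⟨hzs, k, hk, e.symm⟩)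
      · exact Or.inr hzs
    ext z
    constructor
    · intro hz
      by_cases hzB : z ∈ outerBoundary c (m + 1) ζ
      · exact Or.inl hzB
      · refine Or.inr ⟨hzB, h.isBounded_solid.subset ?_⟩
        have hzU : z ∈ U := (hcover hzB).resolve_right fun h1 => h1 hz
        refine Set.Subset.trans ?_ hUs
        refine isPreconnected_connectedComponentIn.subset_left_of_subset_union hUo
          (isClosed_solid h.one_lt m).isOpen_compl ?_
          ((connectedComponentIn_subset _ _).trans hcover) ⟨z, mem_connectedComponentIn hzB, hzU⟩
        exact Set.disjoint_left.2 fun x hx hx' => hx' (hUs hx)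
    · rintro (hz | ⟨-, hz⟩)
      · exact hB hz
      · by_contra hzs
        exact h.not_isBounded_component hB hzs hz

end Crossing

/-- The hypotheses on `ζ`, in the coordinates scaled by `c`. -/
theorem IsZeta.exists_crossing {c : ℂ} (hc : 1 < ‖c‖) (him : 0 < c.im) {n : ℕ} {ζ : ℂ}
    (hζ : IsZeta c n ζ) (hlow : ζ.im ≤ -1) :
    ∃ m t, n = m + 1 ∧ Crossing c m t ∧ c * ζ = ⟨t, -1⟩ := by
  obtain ⟨⟨⟨hn, -⟩, hleast⟩, hζL, hζP⟩ := hζ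
  obtain ⟨m, rfl⟩ : ∃ m, n = m + 1 := ⟨n - 1, by omega⟩
  have hcim : (c * ζ).im = -1 := (mem_PFL_iff c ζ).1 hζP
  have hcζ : c * ζ = ⟨(c * ζ).re, -1⟩ := Complex.ext rfl hcim
  rw [Lseg_natCast] at hζL
  have hmem := mul_mem_segment (c := c) hζL
  rw [mul_spiralPt_succ hc, mul_spiralPt_succ hc] at hmem
  refine ⟨m, (c * ζ).re, rfl, ⟨hc, him, ?_, by rwa [← hcζ], ?_⟩, hcζ⟩
  · intro k
    induction k with
    | zero => intro _; rw [spiralPt_zero]; exact neg_one_lt_ell0_im hc him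
    | succ k ih =>
      intro hk
      have hx := ih (by omega)
      by_contra! hy
      -- otherwise `L_{k+1}` would meet the pre-folding line
      set x := (spiralPt c k).im
      set y := (spiralPt c (k + 1)).im
      have hxy : 0 < x - y := by linarith
      have hk' : k + 1 ∈ {k : ℕ | 0 < k ∧ (Lseg c k ∩ PFL c).Nonempty} := by
        refine ⟨by omega, ((-1 - y) / (x - y)) • spiralPt c (k + 1) +
          ((x + 1) / (x - y)) • spiralPt c (k + 1 + 1), ?_, ?_⟩
        · rw [Lseg_natCast]
          refine ⟨_, _, div_nonneg (by linarith) hxy.le, div_nonneg (by linarith) hxy.le, ?_, rfl⟩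
          rw [← add_div, div_eq_one_iff_eq hxy.ne']; ring
        · rw [mem_PFL_iff, mul_add, mul_smul_comm, mul_smul_comm, mul_spiralPt_succ hc,
            mul_spiralPt_succ hc, add_im, real_smul, real_smul, im_ofReal_mul, im_ofReal_mul]
          change (-1 - y) / (x - y) * x + (x + 1) / (x - y) * y = -1
          field_simp
          ring
      have := hleast hk'
      omega
  · have h1 : c.im * (c * ζ).re = normSq c * (-ζ.im) + c.re * (c * ζ).im := by
      rw [normSq_apply, mul_re, mul_im]; ring
    rw [h1, hcim]
    nlinarith [one_lt_normSq hc]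

end TTM

theorem mainTheorem1 (c : ℂ) (hc : 1 < ‖c‖) (him : 0 < c.im) (n : ℕ) (ζ : ℂ)
    (hζ : TTM.IsZeta c n ζ) (hlow : ζ.im ≤ -1) :
    TTM.IsPolygonBoundedBy (TTM.P c) (TTM.outerBoundary c n ζ) ∧
      TTM.P c = TTM.K c ∧ TTM.gamma0 c ∈ TTM.K c := by
  obtain ⟨m, t, rfl, h, hcζ⟩ := hζ.exists_crossing hc him hlow
  rw [h.P_eq_solid, ← h.solid_eq_K]
  exact ⟨h.isPolygonBoundedBy hcζ, rfl, h.gamma0_mem_solid⟩
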